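/- Let $p,n\ge 1$ and let $f_1,\dots,f_n,g\in\mathbb{C}[x_1,\dots,x_p]$. Assume that every $f_j$ satisfies Mahler's Hypothesis: $f_j$ is non-constant, $f_j(x)\neq 0$ for all $x\in[0,\infty)^p$, and the homogeneous part of $f_j$ of degree $\deg f_j$ does not vanish at any $x\in[0,\infty)^p$ with $x\ne 0$. For $f=f_1,\dots,f_n$ or $f=\prod_{j=1}^n f_j$, choose a continuous branch of $\log f$ on $[0,\infty)^p$ and put $$\zeta(s;f,g)=\sum_{k_1=0}^\infty\cdots\sum_{k_p=0}^\infty g(k_1,\dots,k_p)\,f(k_1,\dots,k_p)^{-s},\qquad f(k)^{-s}:=e^{-s\log f(k)} .$$ This series converges absolutely for $\mathrm{Re}(s)$ sufficiently large and extends to a meromorphic function of $s\in\mathbb{C}$ which is regular at $s=0$; its value $\zeta(0;f,g)$ there does not depend on the chosen branch. These values satisfy the product rule $$\deg\Big(\prod_{j=1}^n f_j\Big)\cdot\zeta\Big(0;\prod_{j=1}^n f_j,\,g\Big)=\sum_{j=1}^n\deg(f_j)\cdot\zeta(0;f_j,g).$$ -/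

import Mathlib

/-- The closed octant `[0,∞)^p` in `ℝ^p`. -/
def octant (p : ℕ) : Set (Fin p → ℝ) := {x | ∀ i, 0 ≤ x i}

/-- The value at a real point of a polynomial with complex coefficients. -/
noncomputable def evalReal {p : ℕ} (f : MvPolynomial (Fin p) ℂ) (x : Fin p → ℝ) : ℂ :=
  MvPolynomial.eval (fun i => (x i : ℂ)) f

/-- The top-degree homogeneous part of a polynomial. -/
noncomputable def topPart {p : ℕ} (f : MvPolynomial (Fin p) ℂ) : MvPolynomial (Fin p) ℂ :=
  MvPolynomial.homogeneousComponent f.totalDegree f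

/-- Mahler's Hypothesis: `f` is non-constant, it has no zero in the closed octant, and its
top-degree homogeneous part has no zero in the closed octant other than the origin. -/
structure MahlerHypothesis {p : ℕ} (f : MvPolynomial (Fin p) ℂ) : Prop where
  nonconstant : 0 < f.totalDegree
  ne_zero : ∀ x ∈ octant p, evalReal f x ≠ 0
  top_ne_zero : ∀ x ∈ octant p, x ≠ 0 → evalReal (topPart f) x ≠ 0

/-- `ℓ` is a continuous branch of `log f` on the closed octant. -/
structure IsLogBranch {p : ℕ} (f : MvPolynomial (Fin p) ℂ) (ℓ : (Fin p → ℝ) → ℂ) : Prop where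
  continuousOn : ContinuousOn ℓ (octant p)
  exp_eq : ∀ x ∈ octant p, Complex.exp (ℓ x) = evalReal f x

/-- The term `g(k) f(k)^{-s}` of the Dirichlet series, where the power `f(k)^{-s}` is formed with
the branch `ℓ` of `log f`. -/
noncomputable def zetaTerm {p : ℕ} (g : MvPolynomial (Fin p) ℂ) (ℓ : (Fin p → ℝ) → ℂ) (s : ℂ)
    (k : Fin p → ℕ) : ℂ :=
  evalReal g (fun i => (k i : ℝ)) * Complex.exp (-s * ℓ (fun i => (k i : ℝ)))

/-- `F` is a meromorphic function on `ℂ`, regular at `0`, to which the Dirichlet series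
`∑ g(k) f(k)^{-s}` (formed with the branch `ℓ` of `log f`) converges absolutely in some right
half-plane. -/
structure IsZetaContinuation {p : ℕ} (g : MvPolynomial (Fin p) ℂ) (ℓ : (Fin p → ℝ) → ℂ)
    (F : ℂ → ℂ) : Prop where
  meromorphicOn : MeromorphicOn F Set.univ
  analyticAt_zero : AnalyticAt ℂ F 0
  hasSum : ∃ σ : ℝ, ∀ s : ℂ, σ < s.re → HasSum (zetaTerm g ℓ s) (F s)

/-- `v` is the value `ζ(0; f, g)` at `s = 0` obtained by analytic continuation of the Dirichlet
series `∑ g(k) f(k)^{-s}`, for some continuous branch of `log f`. -/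
def IsZetaValueAtZero {p : ℕ} (f g : MvPolynomial (Fin p) ℂ) (v : ℂ) : Prop :=
  ∃ (ℓ : (Fin p → ℝ) → ℂ) (F : ℂ → ℂ), IsLogBranch f ℓ ∧ IsZetaContinuation g ℓ F ∧ F 0 = v

/-! Give each factor its own exponent: for a polynomial P put Z(P; s) = ∑ P(k) ∏ f_j(k)^{-s_j} with
s ∈ ℂ^n, d_j = deg f_j and q(s) = 2^{-∑ d_j s_j}. The series of the theorem are Z(g; t a) along a =
e_j and along a = (1, …, 1). It suffices that, for every direction a with δ = ∑ d_j a_j > 0, δ times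
the value at t = 0 is linear in a: the product rule is then the identity (1, …, 1) = ∑ e_j.

The continuation comes from splitting k = 2m + ε by parity. Mahler's Hypothesis gives f_j(2m + ε) =
2^{d_j} f_j(m) (1 + u_j) with u_j = O(1/weight), and off a finite set the chosen logarithms respect
this factorization. Expanding (1 + u_j)^{-s_j} binomially expresses (1 - 2^{p+b} q(s)) Z(P; s),
where deg P ≤ b, through series of the same kind of lower order and a remainder that converges in a
larger half space (`dyadic_functional_equation`). By iteration, ∏_{i<M} (1 - 2^{p+b-i} q) · Z
extends holomorphically to Re ∑ d_j s_j > b + p - M (`exists_continuation`).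

At s = 0 the binomial coefficients of positive order vanish, and so does the remainder; what is left
is a series whose polynomial has smaller degree, and finally the zero polynomial. So for M > p + b
the extension G has G(0) = 0. Among the factors only 1 - q vanishes at 0, and with D the product of
the others, G(ta) / (D(ta)(1 - q(ta))) tends to dG_0(a) / (D(0) δ log 2). This gives regularity and,
after multiplication by δ, linearity (`exists_linear_value`). Changing the branch multiplies the
series by some e^{-sc}, which is 1 at s = 0. -/

section

open Filter Topology

/-! ### Holomorphic series and gluing of meromorphic functions -/

/-- A series of holomorphic functions that is dominated by a convergent series on a ball is
differentiable at the centre. -/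
theorem differentiableAt_tsum_of_norm_le {α E : Type*} [NormedAddCommGroup E] [NormedSpace ℂ E]
    {u : α → ℝ} {F : α → E → ℂ} {x : E} {r : ℝ} (hr : 0 < r) (hu : Summable u)
    (hF : ∀ k, DifferentiableOn ℂ (F k) (Metric.ball x r))
    (hb : ∀ k, ∀ y ∈ Metric.ball x r, ‖F k y‖ ≤ u k) :
    DifferentiableAt ℂ (fun y => ∑' k, F k y) x := by
  let _ : NormedSpace ℝ E := NormedSpace.restrictScalars ℝ ℂ _
  have hx : x ∈ Metric.ball x (r / 2) := Metric.mem_ball_self (by positivity)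
  have hsub : ∀ y ∈ Metric.ball x (r / 2), Metric.ball y (r / 2) ⊆ Metric.ball x r := by
    intro y hy
    apply Metric.ball_subset_ball'
    rw [Metric.mem_ball] at hy
    linarith
  -- The bound on the derivatives is Cauchy's estimate on balls of radius `r / 2`, where `F k` stays
  -- within `2 * u k` of its value at the centre.
  refine (hasFDerivAt_tsum_of_isPreconnected (f' := fun k y => fderiv ℂ (F k) y)
    (u := fun k => (2 * u k) / (r / 2)) ((hu.mul_left 2).div_const _) Metric.isOpen_ball
    (convex_ball x (r / 2)).isPreconnected (fun k y hy => ?_) (fun k y hy => ?_) hx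
    (Summable.of_norm_bounded hu fun k => hb k x (Metric.mem_ball_self hr)) hx).differentiableAt
  · exact (((hF k).mono (hsub y hy)).differentiableAt
      (Metric.ball_mem_nhds y (by positivity))).hasFDerivAt
  · refine Complex.norm_fderiv_le_div_of_mapsTo_ball ((hF k).mono (hsub y hy)) ?_ (by positivity)
    intro z hz
    rw [Metric.mem_closedBall, dist_eq_norm]
    have h1 := hb k z (hsub y hy hz)
    have h2 := hb k y (hsub y hy (Metric.mem_ball_self (by positivity)))
    linarith [norm_sub_le (F k z) (F k y)]

/-- Identity theorem: infinite order of the difference `F - G` at one point of a preconnected set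
propagates to every other point. -/
theorem MeromorphicOn.eventuallyEq_of_isPreconnected {F G : ℂ → ℂ} {U : Set ℂ}
    (hU : IsPreconnected U) (hF : MeromorphicOn F U) (hG : MeromorphicOn G U) {x y : ℂ}
    (hx : x ∈ U) (hy : y ∈ U) (h : F =ᶠ[𝓝[≠] x] G) : F =ᶠ[𝓝[≠] y] G := by
  have key : meromorphicOrderAt (F - G) y = ⊤ := by
    by_contra hne
    refine (hF.sub hG).meromorphicOrderAt_ne_top_of_isPreconnected hU hy hx hne ?_
    rw [meromorphicOrderAt_eq_top_iff]
    filter_upwards [h] with z hz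
    simp [hz]
  rw [meromorphicOrderAt_eq_top_iff] at key
  filter_upwards [key] with z hz
  simpa [sub_eq_zero] using hz

/-- Meromorphic functions on growing half planes that agree on the first of them glue to a
meromorphic function on the plane. -/
theorem exists_meromorphicOn_univ_of_halfPlanes {φ : ℂ → ℂ} {σ c : ℝ} (hc : 0 < c)
    {F : ℕ → ℂ → ℂ} (hF : ∀ M : ℕ, MeromorphicOn (F M) {t | σ - c * M < t.re})
    (hφ : ∀ M t, σ < t.re → F M t = φ t) :
    ∃ G : ℂ → ℂ, MeromorphicOn G Set.univ ∧ (∀ t, σ < t.re → G t = φ t) ∧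
      ∀ (M : ℕ) (t : ℂ), σ - c * M < t.re → G =ᶠ[𝓝[≠] t] F M := by
  have agree : ∀ (M K : ℕ) (t : ℂ), σ - c * M < t.re → σ - c * K < t.re →
      F M =ᶠ[𝓝[≠] t] F K := by
    intro M K t hM hK
    have hle : ∀ M K : ℕ, M ≤ K → {t : ℂ | σ - c * M < t.re} ⊆ {t | σ - c * K < t.re} := by
      intro M K hMK t ht
      have : (M : ℝ) ≤ K := by exact_mod_cast hMK
      simp only [Set.mem_ofPred_eq] at ht ⊢
      nlinarith
    have hx : ∀ M : ℕ, ((σ + 1 : ℝ) : ℂ) ∈ {t : ℂ | σ - c * M < t.re} := by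
      intro M
      have : 0 ≤ c * M := by positivity
      simp only [Set.mem_ofPred_eq, Complex.ofReal_re]
      linarith
    have hev : ∀ M K : ℕ, F M =ᶠ[𝓝[≠] ((σ + 1 : ℝ) : ℂ)] F K := by
      intro M K
      apply Filter.Eventually.filter_mono nhdsWithin_le_nhds
      have : {t : ℂ | σ < t.re} ∈ 𝓝 ((σ + 1 : ℝ) : ℂ) :=
        (isOpen_lt continuous_const Complex.continuous_re).mem_nhds (by simp)
      filter_upwards [this] with z hz
      rw [hφ M z hz, hφ K z hz]
    have main : ∀ M K : ℕ, M ≤ K → σ - c * M < t.re → F M =ᶠ[𝓝[≠] t] F K := by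
      intro M K hMK hM
      exact MeromorphicOn.eventuallyEq_of_isPreconnected
        (convex_halfSpace_re_gt _).isPreconnected (hF M) ((hF K).mono_set (hle M K hMK)) (hx M) hM
        (hev M K)
    rcases le_total M K with h | h
    · exact main M K h hM
    · exact (main K M h hK).symm
  -- The summand 2 leaves a margin `2 * c`: the half plane with index `N z` still contains every
  -- point within distance `c` of `z`.
  set N : ℂ → ℕ := fun t => ⌈|σ - t.re| / c⌉₊ + 2 with hN
  have hNlow : ∀ t, σ - c * N t ≤ t.re - 2 * c := by
    intro t
    have h1 := Nat.le_ceil (|σ - t.re| / c)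
    rw [div_le_iff₀ hc] at h1
    simp only [hN]
    push_cast
    linarith [le_abs_self (σ - t.re)]
  have hG : ∀ (M : ℕ) (t : ℂ), σ - c * M < t.re → (fun t => F (N t) t) =ᶠ[𝓝[≠] t] F M := by
    intro M t hM
    -- On the `c`-ball around `t` the index `N` is at most `N t + 1`, so only finitely many of the
    -- functions have to be compared near `t`.
    set K := N t + 2 with hK
    have hball : ∀ᶠ z in 𝓝[≠] t, dist z t < c :=
      nhdsWithin_le_nhds (Metric.ball_mem_nhds t hc)
    have hall : ∀ᶠ z in 𝓝[≠] t, ∀ L ∈ Finset.range (K + 1), σ - c * L < t.re → F L z = F M z := by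
      rw [Filter.eventually_all_finset]
      intro L _
      by_cases hL : σ - c * L < t.re
      · filter_upwards [agree L M t hL hM] with z hz _ using hz
      · exact Eventually.of_forall fun z h => absurd h hL
    filter_upwards [hball, hall] with z hz hz'
    have hre : |z.re - t.re| < c := by
      calc |z.re - t.re| = |(z - t).re| := by simp
        _ ≤ ‖z - t‖ := Complex.abs_re_le_norm _
        _ < c := by rwa [← dist_eq_norm]
    rw [abs_lt] at hre
    apply hz'
    · rw [Finset.mem_range, Nat.lt_succ_iff, hK, hN]
      simp only
      have : ⌈|σ - z.re| / c⌉₊ ≤ ⌈|σ - t.re| / c⌉₊ + 1 := by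
        rw [Nat.ceil_le]
        push_cast
        have h1 := Nat.le_ceil (|σ - t.re| / c)
        have h2 : |σ - z.re| / c ≤ |σ - t.re| / c + 1 := by
          rw [div_add_one hc.ne']
          gcongr
          rw [abs_le]
          constructor <;> cases abs_cases (σ - t.re) <;> linarith
        linarith
      omega
    · linarith [hNlow z]
  refine ⟨fun t => F (N t) t, fun t _ => ?_, fun t ht => hφ _ t ht, hG⟩
  have ht : σ - c * N t < t.re := by linarith [hNlow t]
  exact (hF (N t) t ht).congr (hG (N t) t ht).symm

/-! ### Binomial expansion, uniform in the exponent -/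

/-- The coefficients of the binomial series of `(1 + u) ^ (-s)`. -/
noncomputable def negBinom : ℕ → ℂ → ℂ
  | 0, _ => 1
  | l + 1, s => -s / (l + 1) * negBinom l (s + 1)

theorem differentiable_negBinom (l : ℕ) : Differentiable ℂ (negBinom l) := by
  induction l with
  | zero => exact differentiable_const _
  | succ l ih =>
    have : Differentiable ℂ fun s : ℂ => negBinom l (s + 1) :=
      ih.comp (differentiable_id.add_const 1)
    exact (differentiable_id.neg.div_const _).mul this

theorem negBinom_succ_zero (l : ℕ) : negBinom (l + 1) 0 = 0 := by simp [negBinom]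

/-- Induction on `N`: the derivative in `u` of the remainder of order `N + 1` with exponent `s` is
`-s` times the remainder of order `N` with exponent `s + 1`, and the mean value inequality gains one
power of `‖u‖`. The shift of `s` is why `K` is quantified inside the induction. -/
theorem exists_norm_one_add_cpow_sub_le (N : ℕ) : ∀ K : ℝ, ∃ C : ℝ, 0 ≤ C ∧
    ∀ s u : ℂ, ‖s‖ ≤ K → ‖u‖ ≤ 1 / 2 →
      ‖Complex.exp (-s * Complex.log (1 + u)) - ∑ l ∈ Finset.range N, negBinom l s * u ^ l‖
        ≤ C * ‖u‖ ^ N := by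
  have hslit : ∀ u : ℂ, ‖u‖ ≤ 1 / 2 → 1 + u ∈ Complex.slitPlane := fun u hu =>
    Complex.mem_slitPlane_of_norm_lt_one (by linarith)
  induction N with
  | zero =>
    intro K
    refine ⟨Real.exp (|K| * 1), (Real.exp_pos _).le, fun s u hs hu => ?_⟩
    have hlog : ‖Complex.log (1 + u)‖ ≤ 1 := by
      have := Complex.norm_log_one_add_half_le_self hu
      linarith
    simp only [Finset.range_zero, Finset.sum_empty, sub_zero, pow_zero, mul_one]
    refine (Complex.norm_exp_le_exp_norm _).trans (Real.exp_le_exp.2 ?_)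
    rw [norm_mul, norm_neg]
    calc ‖s‖ * ‖Complex.log (1 + u)‖ ≤ |K| * 1 := by
          gcongr
          exact hs.trans (le_abs_self K)
      _ = |K| := mul_one _
  | succ N ih =>
    intro K
    obtain ⟨C, hC, h⟩ := ih (K + 1)
    refine ⟨|K| * C, by positivity, fun s u hs hu => ?_⟩
    set R : ℂ → ℂ := fun v => Complex.exp (-s * Complex.log (1 + v)) -
      ∑ l ∈ Finset.range (N + 1), negBinom l s * v ^ l with hR
    set R' : ℂ → ℂ := fun v => -s * (Complex.exp (-(s + 1) * Complex.log (1 + v)) -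
      ∑ l ∈ Finset.range N, negBinom l (s + 1) * v ^ l) with hR'
    have hR0 : R 0 = 0 := by
      simp [hR, Finset.sum_range_succ', negBinom]
    have hderiv : ∀ v ∈ Metric.closedBall (0 : ℂ) ‖u‖,
        HasDerivWithinAt R (R' v) (Metric.closedBall 0 ‖u‖) v := by
      intro v hv
      have hv' : ‖v‖ ≤ 1 / 2 := by
        rw [mem_closedBall_zero_iff] at hv
        exact hv.trans hu
      have hne : (1 + v) ≠ 0 := Complex.slitPlane_ne_zero (hslit v hv')
      have h1 : HasDerivAt (fun v => Complex.exp (-s * Complex.log (1 + v)))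
          (Complex.exp (-s * Complex.log (1 + v)) * (-s * (1 / (1 + v)))) v :=
        ((((hasDerivAt_id v).const_add 1).clog (hslit v hv')).const_mul (-s)).cexp
      have h2 : HasDerivAt (fun v => ∑ l ∈ Finset.range (N + 1), negBinom l s * v ^ l)
          (∑ l ∈ Finset.range (N + 1), negBinom l s * (l * v ^ (l - 1))) v :=
        HasDerivAt.fun_sum fun l _ => (hasDerivAt_pow l v).const_mul _
      refine ((h1.sub h2).congr_deriv ?_).hasDerivWithinAt
      simp only [hR']
      rw [Finset.sum_range_succ', mul_sub, Finset.mul_sum]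
      congr 1
      · rw [neg_mul (s + 1), add_mul, one_mul, neg_add, ← neg_mul, Complex.exp_add,
          Complex.exp_neg (Complex.log (1 + v)), Complex.exp_log hne]
        field_simp
      · simp only [Nat.cast_zero, zero_mul, mul_zero, add_zero]
        refine Finset.sum_congr rfl fun l _ => ?_
        have : ((l : ℂ) + 1) ≠ 0 := by exact_mod_cast Nat.succ_ne_zero l
        rw [negBinom, Nat.add_sub_cancel]
        push_cast
        field_simp
    have hbound : ∀ v ∈ Metric.closedBall (0 : ℂ) ‖u‖, ‖R' v‖ ≤ |K| * C * ‖u‖ ^ N := by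
      intro v hv
      rw [mem_closedBall_zero_iff] at hv
      rw [hR', norm_mul, norm_neg, mul_assoc]
      have h1 := h (s + 1) v ((norm_add_le _ _).trans (by simpa using hs)) (hv.trans hu)
      gcongr
      · exact hs.trans (le_abs_self K)
      · exact h1.trans (by gcongr)
    have := (convex_closedBall (0 : ℂ) ‖u‖).norm_image_sub_le_of_norm_hasDerivWithin_le hderiv
      hbound (x := 0) (y := u) (by simp) (by simp)
    rw [hR0, sub_zero, sub_zero] at this
    rw [pow_succ, ← mul_assoc]
    exact this

theorem norm_prod_sub_prod_le_of_norm_le {ι : Type*} (t : Finset ι) {A B : ι → ℂ} {K δ : ℝ}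
    (hK : 1 ≤ K) (hA : ∀ j ∈ t, ‖A j‖ ≤ K) (hB : ∀ j ∈ t, ‖B j‖ ≤ K)
    (hAB : ∀ j ∈ t, ‖A j - B j‖ ≤ δ) :
    ‖∏ j ∈ t, A j - ∏ j ∈ t, B j‖ ≤ t.card * K ^ t.card * δ := by
  classical
  induction t using Finset.induction_on with
  | empty => simp
  | insert a t ha ih =>
    have hδ : 0 ≤ δ := (norm_nonneg _).trans (hAB a (Finset.mem_insert_self a t))
    have ih' := ih (fun j hj => hA j (Finset.mem_insert_of_mem hj))
      (fun j hj => hB j (Finset.mem_insert_of_mem hj))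
      (fun j hj => hAB j (Finset.mem_insert_of_mem hj))
    have hBprod : ‖∏ j ∈ t, B j‖ ≤ K ^ t.card := by
      rw [norm_prod]
      calc ∏ j ∈ t, ‖B j‖ ≤ ∏ j ∈ t, K := Finset.prod_le_prod (fun _ _ => norm_nonneg _)
            fun j hj => hB j (Finset.mem_insert_of_mem hj)
        _ = K ^ t.card := by simp
    rw [Finset.prod_insert ha, Finset.prod_insert ha, Finset.card_insert_of_notMem ha]
    have e : A a * ∏ j ∈ t, A j - B a * ∏ j ∈ t, B j =
        A a * (∏ j ∈ t, A j - ∏ j ∈ t, B j) + (A a - B a) * ∏ j ∈ t, B j := by ring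
    rw [e]
    refine (norm_add_le _ _).trans ?_
    rw [norm_mul, norm_mul]
    have h1 : ‖A a‖ * ‖∏ j ∈ t, A j - ∏ j ∈ t, B j‖ ≤ K * (t.card * K ^ t.card * δ) :=
      mul_le_mul (hA a (Finset.mem_insert_self a t)) ih' (norm_nonneg _) (by linarith)
    have h2 : ‖A a - B a‖ * ‖∏ j ∈ t, B j‖ ≤ δ * K ^ t.card :=
      mul_le_mul (hAB a (Finset.mem_insert_self a t)) hBprod (norm_nonneg _) hδ
    have h3 : δ * K ^ t.card ≤ δ * K ^ (t.card + 1) := by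
      gcongr
      omega
    push_cast
    calc _ ≤ K * (t.card * K ^ t.card * δ) + δ * K ^ (t.card + 1) := by linarith
      _ = _ := by ring

/-! ### Lattice sums and the weight -/

theorem summable_pi_prod {f : ℕ → ℝ} (hf0 : ∀ k, 0 ≤ f k) (hf : Summable f) (p : ℕ) :
    Summable fun m : Fin p → ℕ => ∏ i, f (m i) := by
  induction p with
  | zero => exact Summable.of_finite
  | succ p ih =>
    rw [← (Fin.consEquiv fun _ : Fin (p + 1) => ℕ).summable_iff]
    have := hf.mul_of_nonneg ih hf0 fun m => Finset.prod_nonneg fun i _ => hf0 _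
    refine this.congr fun x => ?_
    simp [Fin.prod_univ_succ, Fin.consEquiv]

/-- The weight `1 + x_1 + ⋯ + x_p`. -/
noncomputable def weight {p : ℕ} (x : Fin p → ℝ) : ℝ := 1 + ∑ i, x i

theorem one_le_weight {p : ℕ} {x : Fin p → ℝ} (hx : x ∈ octant p) : 1 ≤ weight x := by
  have : 0 ≤ ∑ i, x i := Finset.sum_nonneg fun i _ => hx i
  unfold weight
  linarith

theorem natCast_mem_octant {p : ℕ} (m : Fin p → ℕ) : (fun i => (m i : ℝ)) ∈ octant p :=
  fun _ => Nat.cast_nonneg _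

/-- The weight of a lattice point. -/
noncomputable def natWeight {p : ℕ} (m : Fin p → ℕ) : ℝ := weight fun i => (m i : ℝ)

theorem one_le_natWeight {p : ℕ} (m : Fin p → ℕ) : 1 ≤ natWeight m :=
  one_le_weight (natCast_mem_octant m)

theorem natWeight_pos {p : ℕ} (m : Fin p → ℕ) : 0 < natWeight m :=
  one_pos.trans_le (one_le_natWeight m)

theorem one_add_le_natWeight {p : ℕ} (m : Fin p → ℕ) (i : Fin p) : 1 + (m i : ℝ) ≤ natWeight m := by
  have := Finset.single_le_sum (f := fun i => (m i : ℝ)) (fun i _ => Nat.cast_nonneg _)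
    (Finset.mem_univ i)
  unfold natWeight weight
  linarith

/-- The weight dominates each `1 + m i`, so for negative `c` its power is at most `∏ (1 + m i) ^ (c
/ p)`, a product of convergent one-variable series. -/
theorem summable_natWeight_rpow {p : ℕ} {c : ℝ} (hc : c < -p) :
    Summable fun m : Fin p → ℕ => natWeight m ^ c := by
  rcases Nat.eq_zero_or_pos p with rfl | hp
  · exact Summable.of_finite
  have hp' : (0 : ℝ) < p := by exact_mod_cast hp
  have hcp : c / p < -1 := by
    rw [div_lt_iff₀ hp']
    linarith
  have hs : Summable fun k : ℕ => (1 + (k : ℝ)) ^ (c / p) := by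
    have := (summable_nat_add_iff 1).2 (Real.summable_nat_rpow.2 hcp)
    refine this.congr fun k => ?_
    push_cast
    rw [add_comm]
  refine Summable.of_nonneg_of_le (fun m => Real.rpow_nonneg (natWeight_pos m).le _) (fun m => ?_)
    (summable_pi_prod (fun k => by positivity) hs p)
  calc natWeight m ^ c = ∏ _ : Fin p, natWeight m ^ (c / p) := by
        rw [Finset.prod_const, Finset.card_univ, Fintype.card_fin, ← Real.rpow_natCast,
          ← Real.rpow_mul (natWeight_pos m).le, div_mul_cancel₀ _ hp'.ne']
    _ ≤ ∏ i, (1 + (m i : ℝ)) ^ (c / p) := by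
        refine Finset.prod_le_prod (fun _ _ => Real.rpow_nonneg (natWeight_pos m).le _) fun i _ => ?_
        exact Real.rpow_le_rpow_of_nonpos (by positivity) (one_add_le_natWeight m i) (by linarith)

theorem finite_natWeight_le {p : ℕ} (R : ℝ) : {m : Fin p → ℕ | natWeight m ≤ R}.Finite := by
  refine (Set.Finite.pi' (t := fun _ : Fin p => {k : ℕ | (k : ℝ) ≤ R}) fun i => ?_).subset ?_
  · refine (Set.finite_Iic ⌊R⌋₊).subset fun k hk => Nat.le_floor hk
  · intro m hm i
    have := one_add_le_natWeight m i
    simp only [Set.mem_ofPred_eq] at hm ⊢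
    linarith

theorem tendsto_natWeight_atTop {p : ℕ} :
    Tendsto (natWeight : (Fin p → ℕ) → ℝ) cofinite atTop := by
  refine tendsto_atTop.2 fun R => ?_
  refine (finite_natWeight_le R).subset fun m hm => ?_
  simp only [Set.mem_compl_iff, Set.mem_ofPred_eq, not_le] at hm
  exact hm.le

/-! ### Continuous logarithms, degree bounds and the substitution x ↦ 2x + ε -/

/-- A continuous function without zeros on a nonempty convex set has a continuous logarithm. -/
theorem Convex.exists_continuousOn_exp_eq {E : Type*} [NormedAddCommGroup E] [NormedSpace ℝ E]
    {S : Set E} (hS : Convex ℝ S) (hne : S.Nonempty) {g : E → ℂ} (hg : ContinuousOn g S)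
    (h0 : ∀ x ∈ S, g x ≠ 0) :
    ∃ L : E → ℂ, ContinuousOn L S ∧ ∀ x ∈ S, Complex.exp (L x) = g x := by
  classical
  have := hS.contractibleSpace hne
  have := hS.locallyPathConnectedSpace
  obtain ⟨x₀, hx₀⟩ := hne
  obtain ⟨L, ⟨-, hL⟩, -⟩ := Complex.isCoveringMapOn_exp.existsUnique_continuousMap_lifts
    (A := S) ⟨S.domRestrict g, continuousOn_iff_continuous_domRestrict.mp hg⟩
    (a₀ := ⟨x₀, hx₀⟩) (e₀ := Complex.log (g x₀)) (Complex.exp_log (h0 x₀ hx₀))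
    (fun x => h0 x x.2)
  refine ⟨fun x => if hx : x ∈ S then L ⟨x, hx⟩ else 0, ?_, fun x hx => ?_⟩
  · rw [continuousOn_iff_continuous_domRestrict]
    refine (map_continuous L).congr fun x => ?_
    simp
  · simpa [hx] using congrFun hL ⟨x, hx⟩

/-- `P` has total degree at most the integer `b`, where the zero polynomial has degree `-∞`. -/
def DegLE {p : ℕ} (P : MvPolynomial (Fin p) ℂ) (b : ℤ) : Prop := P = 0 ∨ (P.totalDegree : ℤ) ≤ b

namespace DegLE

variable {p : ℕ} {P Q : MvPolynomial (Fin p) ℂ} {a b : ℤ}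

theorem zero : DegLE (0 : MvPolynomial (Fin p) ℂ) b := Or.inl rfl

theorem of_totalDegree (P : MvPolynomial (Fin p) ℂ) : DegLE P P.totalDegree := Or.inr le_rfl

theorem mono (h : DegLE P a) (hab : a ≤ b) : DegLE P b := h.imp id fun h => h.trans hab

theorem eq_zero (h : DegLE P b) (hb : b < 0) : P = 0 := by
  rcases h with h | h
  · exact h
  · omega

theorem add (hP : DegLE P b) (hQ : DegLE Q b) : DegLE (P + Q) b := by
  rcases hP with rfl | hP
  · simpa using hQ
  rcases hQ with rfl | hQ
  · rw [add_zero]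
    exact Or.inr hP
  refine Or.inr ?_
  have := MvPolynomial.totalDegree_add P Q
  rcases le_max_iff.1 this with h | h <;> omega

theorem mul (hP : DegLE P a) (hQ : DegLE Q b) : DegLE (P * Q) (a + b) := by
  rcases hP with rfl | hP
  · simpa using zero
  rcases hQ with rfl | hQ
  · simpa using zero
  have := MvPolynomial.totalDegree_mul P Q
  exact Or.inr (by omega)

theorem const (c : ℂ) : DegLE (MvPolynomial.C c : MvPolynomial (Fin p) ℂ) 0 :=
  Or.inr (by simp)

theorem const_mul (c : ℂ) (hP : DegLE P b) : DegLE (MvPolynomial.C c * P) b := by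
  simpa using (const c).mul hP

theorem sub (hP : DegLE P b) (hQ : DegLE Q b) : DegLE (P - Q) b := by
  have := hP.add (hQ.const_mul (-1))
  simpa [sub_eq_add_neg] using this

theorem sum {α : Type*} {t : Finset α} {F : α → MvPolynomial (Fin p) ℂ}
    (h : ∀ i ∈ t, DegLE (F i) b) : DegLE (∑ i ∈ t, F i) b := by
  classical
  induction t using Finset.induction_on with
  | empty => simpa using zero
  | insert i t hi ih =>
    rw [Finset.sum_insert hi]
    exact (h i (Finset.mem_insert_self i t)).add
      (ih fun j hj => h j (Finset.mem_insert_of_mem hj))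

theorem pow (hP : DegLE P b) (l : ℕ) : DegLE (P ^ l) (l * b) := by
  induction l with
  | zero => simpa using const (p := p) 1
  | succ l ih =>
    rw [pow_succ]
    refine (ih.mul hP).mono (le_of_eq ?_)
    push_cast
    ring

theorem prod {α : Type*} {t : Finset α} {F : α → MvPolynomial (Fin p) ℂ} {B : α → ℤ}
    (h : ∀ i ∈ t, DegLE (F i) (B i)) : DegLE (∏ i ∈ t, F i) (∑ i ∈ t, B i) := by
  classical
  induction t using Finset.induction_on with
  | empty => simpa using const (p := p) 1
  | insert i t hi ih =>
    rw [Finset.prod_insert hi, Finset.sum_insert hi]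
    exact (h i (Finset.mem_insert_self i t)).mul
      (ih fun j hj => h j (Finset.mem_insert_of_mem hj))

theorem monomial_of_mem_support (hP : DegLE P b) {s : Fin p →₀ ℕ} (hs : s ∈ P.support) (c : ℂ) :
    DegLE (MvPolynomial.monomial s c) b := by
  rcases hP with rfl | hP
  · simp at hs
  by_cases hc : c = 0
  · simpa [hc] using zero
  refine Or.inr (le_trans ?_ hP)
  rw [MvPolynomial.totalDegree_monomial _ hc]
  exact_mod_cast MvPolynomial.le_totalDegree hs

theorem exists_norm_evalReal_le (hP : DegLE P b) :
    ∃ C : ℝ, 0 ≤ C ∧ ∀ x ∈ octant p, ‖evalReal P x‖ ≤ C * weight x ^ (b : ℝ) := by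
  refine ⟨∑ s ∈ P.support, ‖P.coeff s‖, Finset.sum_nonneg fun _ _ => norm_nonneg _,
    fun x hx => ?_⟩
  have hw := one_le_weight hx
  rw [evalReal, MvPolynomial.eval_eq', Finset.sum_mul]
  refine norm_sum_le_of_le _ fun s hs => ?_
  rw [norm_mul, norm_prod]
  gcongr
  have hsb : (∑ i, (s i : ℤ)) ≤ b := by
    rcases hP with rfl | hP
    · simp at hs
    · refine le_trans ?_ hP
      have := MvPolynomial.le_totalDegree hs
      rw [Finsupp.sum_fintype _ _ fun _ => rfl] at this
      exact_mod_cast this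
  calc ∏ i, ‖((x i : ℝ) : ℂ) ^ s i‖ ≤ ∏ i, weight x ^ s i := by
        refine Finset.prod_le_prod (fun i _ => norm_nonneg _) fun i _ => ?_
        rw [norm_pow, Complex.norm_real, Real.norm_of_nonneg (hx i)]
        refine pow_le_pow_left₀ (hx i) ?_ _
        have := Finset.single_le_sum (fun i _ => hx i) (Finset.mem_univ i)
        unfold weight
        linarith
    _ = weight x ^ ((∑ i, (s i : ℤ) : ℤ) : ℝ) := by
        rw [Finset.prod_pow_eq_pow_sum, ← Real.rpow_natCast]
        push_cast
        rfl
    _ ≤ weight x ^ (b : ℝ) := Real.rpow_le_rpow_of_exponent_le hw (by exact_mod_cast hsb)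

end DegLE

/-- The substitution `x ↦ 2 x + ε`. -/
noncomputable def dilate {p : ℕ} (ε : Fin p → Fin 2) :
    MvPolynomial (Fin p) ℂ →ₐ[ℂ] MvPolynomial (Fin p) ℂ :=
  MvPolynomial.aeval fun i => MvPolynomial.C 2 * MvPolynomial.X i + MvPolynomial.C ((ε i : ℕ) : ℂ)

theorem evalReal_dilate {p : ℕ} (ε : Fin p → Fin 2) (P : MvPolynomial (Fin p) ℂ) (x : Fin p → ℝ) :
    evalReal (dilate ε P) x = evalReal P fun i => 2 * x i + (ε i : ℕ) := by
  unfold evalReal dilate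
  induction P using MvPolynomial.induction_on with
  | C a => simp
  | add P Q hP hQ => simp only [map_add, hP, hQ]
  | mul_X P i hP =>
    simp only [map_mul, hP]
    simp

theorem degLE_X {p : ℕ} (i : Fin p) :
    DegLE (MvPolynomial.X i : MvPolynomial (Fin p) ℂ) 1 := Or.inr (by simp)

/-- The substitution scales the part of degree `b` by `2 ^ b` and otherwise produces only lower
terms. The bound `b` need not be the exact degree: when it is larger, both terms of the difference
already have degree at most `b - 1`. -/
theorem DegLE.dilate_sub {p : ℕ} (ε : Fin p → Fin 2) {P : MvPolynomial (Fin p) ℂ} {b : ℤ}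
    (hP : DegLE P b) :
    DegLE (dilate ε P) b ∧ DegLE (dilate ε P - MvPolynomial.C ((2 : ℂ) ^ b) * P) (b - 1) := by
  have hmon : ∀ (s : Fin p →₀ ℕ) (c : ℂ) (b : ℤ), DegLE (MvPolynomial.monomial s c) b →
      DegLE (dilate ε (MvPolynomial.monomial s c)) b ∧
      DegLE (dilate ε (MvPolynomial.monomial s c) -
        MvPolynomial.C ((2 : ℂ) ^ b) * MvPolynomial.monomial s c) (b - 1) := by
    intro s c
    refine MvPolynomial.induction_on_monomial (motive := fun P => ∀ b : ℤ, DegLE P b →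
      DegLE (dilate ε P) b ∧ DegLE (dilate ε P - MvPolynomial.C ((2 : ℂ) ^ b) * P) (b - 1))
      (fun c b hb => ?_) (fun P i ih b hb => ?_) s c
    · have e : dilate ε (MvPolynomial.C c) = MvPolynomial.C c := by simp [dilate]
      rw [e]
      refine ⟨hb, ?_⟩
      -- For constants: if `b = 0` the difference is zero, and if `b > 0` a constant already has
      -- degree at most `b - 1`.
      by_cases hb0 : b < 0
      · rw [hb.eq_zero hb0]
        simpa using DegLE.zero
      rcases eq_or_lt_of_le (not_lt.1 hb0) with rfl | hb1
      · simpa using DegLE.zero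
      · exact ((DegLE.const c).mono (by omega)).sub
          (((DegLE.const c).const_mul _).mono (by omega))
    · by_cases hP : P = 0
      · simp [hP, DegLE.zero]
      have hPb : DegLE P (b - 1) := by
        rcases hb with h | h
        · simp [hP] at h
        · rw [MvPolynomial.totalDegree_mul_of_isDomain hP (MvPolynomial.X_ne_zero i),
            MvPolynomial.totalDegree_X] at h
          exact Or.inr (by push_cast at h; omega)
      obtain ⟨h1, h2⟩ := ih _ hPb
      have e : dilate ε (P * MvPolynomial.X i) = dilate ε P *
          (MvPolynomial.C 2 * MvPolynomial.X i + MvPolynomial.C ((ε i : ℕ) : ℂ)) := by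
        rw [map_mul]
        simp [dilate]
      rw [e]
      have hX : DegLE (MvPolynomial.C 2 * MvPolynomial.X i + MvPolynomial.C ((ε i : ℕ) : ℂ) :
          MvPolynomial (Fin p) ℂ) 1 :=
        ((degLE_X i).const_mul _).add ((DegLE.const _).mono (by omega))
      refine ⟨(h1.mul hX).mono (by omega), ?_⟩
      have e2 : dilate ε P * (MvPolynomial.C 2 * MvPolynomial.X i + MvPolynomial.C ((ε i : ℕ) : ℂ))
          - MvPolynomial.C ((2 : ℂ) ^ b) * (P * MvPolynomial.X i) =
          (dilate ε P - MvPolynomial.C ((2 : ℂ) ^ (b - 1)) * P) *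
            (MvPolynomial.C 2 * MvPolynomial.X i)
          + dilate ε P * MvPolynomial.C ((ε i : ℕ) : ℂ) := by
        have : (2 : ℂ) ^ b = 2 ^ (b - 1) * 2 := by
          rw [← zpow_add_one₀ (by norm_num)]
          congr 1
          ring
        rw [this, MvPolynomial.C_mul]
        ring
      rw [e2]
      exact ((h2.mul ((degLE_X i).const_mul _)).mono (by omega)).add
        ((h1.mul (DegLE.const _)).mono (by omega))
  have e : P = ∑ s ∈ P.support, MvPolynomial.monomial s (P.coeff s) := P.as_sum
  constructor
  · rw [e, map_sum]
    exact DegLE.sum fun s hs => (hmon s _ b (hP.monomial_of_mem_support hs _)).1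
  · have e' : dilate ε P - MvPolynomial.C ((2 : ℂ) ^ b) * P = ∑ s ∈ P.support,
        (dilate ε (MvPolynomial.monomial s (P.coeff s)) -
          MvPolynomial.C ((2 : ℂ) ^ b) * MvPolynomial.monomial s (P.coeff s)) := by
      rw [Finset.sum_sub_distrib, ← map_sum, ← Finset.mul_sum, ← e]
    rw [e']
    exact DegLE.sum fun s hs => (hmon s _ b (hP.monomial_of_mem_support hs _)).2

/-! ### Compactification of the octant and Mahler's Hypothesis -/

theorem continuous_evalReal {p : ℕ} (f : MvPolynomial (Fin p) ℂ) : Continuous (evalReal f) := by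
  unfold evalReal
  exact (MvPolynomial.continuous_eval f).comp
    (continuous_pi fun i => Complex.continuous_ofReal.comp (continuous_apply i))

theorem MvPolynomial.IsHomogeneous.evalReal_smul {p n : ℕ} {f : MvPolynomial (Fin p) ℂ}
    (hf : f.IsHomogeneous n) (c : ℝ) (x : Fin p → ℝ) :
    evalReal f (c • x) = (c : ℂ) ^ n * evalReal f x := by
  unfold evalReal
  rw [MvPolynomial.eval_eq', MvPolynomial.eval_eq', Finset.mul_sum]
  refine Finset.sum_congr rfl fun s hs => ?_
  have hdeg : ∑ i, s i = n := by
    rw [← Finsupp.degree_eq_sum, Finsupp.degree_eq_weight_one]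
    exact hf (MvPolynomial.mem_support_iff.1 hs)
  simp only [Pi.smul_apply, smul_eq_mul, Complex.ofReal_mul, mul_pow, Finset.prod_mul_distrib]
  rw [Finset.prod_pow_eq_pow_sum, hdeg]
  ring

/-- The corner simplex, onto whose part off the far face the map `x ↦ x / (1 + x_1 + ⋯ + x_p)`
takes the octant. -/
def cornerSimplex (p : ℕ) : Set (Fin p → ℝ) := {y | y ∈ octant p ∧ ∑ i, y i ≤ 1}

theorem isCompact_cornerSimplex (p : ℕ) : IsCompact (cornerSimplex p) := by
  refine (isCompact_univ_pi fun _ : Fin p => isCompact_Icc (a := (0 : ℝ)) (b := 1)).of_isClosed_subset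
    ?_ ?_
  · have h1 : IsClosed (octant p) := by
      have : octant p = ⋂ i, {x | 0 ≤ x i} := by ext; simp [octant]
      rw [this]
      exact isClosed_iInter fun i => isClosed_le continuous_const (continuous_apply i)
    exact h1.inter (isClosed_le (continuous_finsetSum _ fun i _ => continuous_apply i)
      continuous_const)
  · intro y hy i _
    exact ⟨hy.1 i, (Finset.single_le_sum (fun i _ => hy.1 i) (Finset.mem_univ i)).trans hy.2⟩

theorem convex_octant (p : ℕ) : Convex ℝ (octant p) := by
  intro x hx y hy a b ha hb _ i
  have := mul_nonneg ha (hx i)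
  have := mul_nonneg hb (hy i)
  simp only [Pi.add_apply, Pi.smul_apply, smul_eq_mul]
  linarith

theorem convex_cornerSimplex (p : ℕ) : Convex ℝ (cornerSimplex p) := by
  intro x hx y hy a b ha hb hab
  refine ⟨convex_octant p hx.1 hy.1 ha hb hab, ?_⟩
  simp only [Pi.add_apply, Pi.smul_apply, smul_eq_mul, Finset.sum_add_distrib, ← Finset.mul_sum]
  nlinarith [hx.2, hy.2]

theorem inv_weight_smul_mem_cornerSimplex {p : ℕ} {x : Fin p → ℝ} (hx : x ∈ octant p) :
    (weight x)⁻¹ • x ∈ cornerSimplex p := by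
  have hw := one_le_weight hx
  constructor
  · intro i
    have := hx i
    simp only [Pi.smul_apply, smul_eq_mul]
    positivity
  · simp only [Pi.smul_apply, smul_eq_mul, ← Finset.mul_sum]
    rw [inv_mul_le_iff₀ (by linarith)]
    unfold weight
    linarith

/-- The homogenization of `f`, with the extra variable equal to `1 - y_1 - ⋯ - y_p`. -/
noncomputable def homogenizedEval {p : ℕ} (f : MvPolynomial (Fin p) ℂ) (y : Fin p → ℝ) : ℂ :=
  ∑ i ∈ Finset.range (f.totalDegree + 1),
    ((1 - ∑ j, y j : ℝ) : ℂ) ^ (f.totalDegree - i) *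
      evalReal (MvPolynomial.homogeneousComponent i f) y

theorem continuous_homogenizedEval {p : ℕ} (f : MvPolynomial (Fin p) ℂ) :
    Continuous (homogenizedEval f) := by
  unfold homogenizedEval
  refine continuous_finsetSum _ fun i _ => ?_
  refine Continuous.mul ?_ (continuous_evalReal _)
  exact (Complex.continuous_ofReal.comp (continuous_const.sub
    (continuous_finsetSum _ fun i _ => continuous_apply i))).pow _

theorem homogenizedEval_eq {p : ℕ} (f : MvPolynomial (Fin p) ℂ) {t : ℝ} (x : Fin p → ℝ)
    (ht : 1 - ∑ j, t * x j = t) :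
    homogenizedEval f (t • x) = (t : ℂ) ^ f.totalDegree * evalReal f x := by
  have e : evalReal f x = ∑ i ∈ Finset.range (f.totalDegree + 1),
      evalReal (MvPolynomial.homogeneousComponent i f) x := by
    unfold evalReal
    rw [← map_sum, MvPolynomial.sum_homogeneousComponent]
  rw [e, Finset.mul_sum]
  refine Finset.sum_congr rfl fun i hi => ?_
  rw [(MvPolynomial.homogeneousComponent_isHomogeneous i f).evalReal_smul]
  simp only [Pi.smul_apply, smul_eq_mul]
  rw [ht, ← mul_assoc, ← pow_add, Nat.sub_add_cancel (Nat.lt_succ_iff.1 (Finset.mem_range.1 hi))]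

/-- On the far face only the top-degree part survives; elsewhere the value is a positive multiple of
a value of `f` on the octant. The two nonvanishing conditions of the hypothesis cover exactly these
two cases. -/
theorem MahlerHypothesis.homogenizedEval_ne_zero {p : ℕ} {f : MvPolynomial (Fin p) ℂ}
    (hf : MahlerHypothesis f) {y : Fin p → ℝ} (hy : y ∈ cornerSimplex p) :
    homogenizedEval f y ≠ 0 := by
  rcases eq_or_lt_of_le hy.2 with h | h
  · have e : homogenizedEval f y = evalReal (topPart f) y := by
      unfold homogenizedEval topPart
      rw [Finset.sum_range_succ, Finset.sum_eq_zero, h]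
      · simp
      · intro i hi
        have : f.totalDegree - i ≠ 0 := by
          have := Finset.mem_range.1 hi
          omega
        simp [h, this]
    rw [e]
    refine hf.top_ne_zero y hy.1 ?_
    rintro rfl
    simp at h
  · set t : ℝ := 1 - ∑ i, y i with ht
    have htpos : 0 < t := by linarith
    have hyt : y = t • (t⁻¹ • y) := by rw [smul_smul, mul_inv_cancel₀ htpos.ne', one_smul]
    rw [hyt, homogenizedEval_eq]
    · refine mul_ne_zero (pow_ne_zero _ (by exact_mod_cast htpos.ne')) (hf.ne_zero _ fun i => ?_)
      have := hy.1 i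
      simp only [Pi.smul_apply, smul_eq_mul]
      positivity
    · rw [ht]
      congr 1
      refine Finset.sum_congr rfl fun i _ => ?_
      simp only [Pi.smul_apply, smul_eq_mul]
      rw [← ht, ← mul_assoc, mul_inv_cancel₀ htpos.ne', one_mul]

/-! ### Branches of the logarithm under dilation -/

/-- The relative error of the approximation `f(2m + ε) ≈ 2 ^ deg f * f(m)`. -/
noncomputable def dilateError {p : ℕ} (f : MvPolynomial (Fin p) ℂ) (ε : Fin p → Fin 2)
    (m : Fin p → ℕ) : ℂ :=
  evalReal (dilate ε f - MvPolynomial.C ((2 : ℂ) ^ (f.totalDegree : ℤ)) * f) (fun i => (m i : ℝ)) /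
    ((2 : ℂ) ^ f.totalDegree * evalReal f fun i => (m i : ℝ))

/-- The values on `ℕ^p` of a branch of `log f`, with the properties used for the continuation. -/
structure IsLatticeLog {p : ℕ} (f : MvPolynomial (Fin p) ℂ) (ℓ : (Fin p → ℕ) → ℂ) : Prop where
  exp_eq : ∀ m, Complex.exp (ℓ m) = evalReal f fun i => (m i : ℝ)
  bound : ∃ B : ℝ, ∀ m, ‖ℓ m - f.totalDegree * Real.log (natWeight m)‖ ≤ B
  error_bound : ∃ C : ℝ, ∀ ε m, ‖dilateError f ε m‖ ≤ C / natWeight m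
  dilate_eq : ∀ ε : Fin p → Fin 2, ∀ᶠ m in cofinite, ℓ (fun i => 2 * m i + (ε i : ℕ)) =
    ℓ m + f.totalDegree * Complex.log 2 + Complex.log (1 + dilateError f ε m)

/-- The numerator has degree at most `deg f - 1`, while the bound on the logarithm keeps `|f|` above
a constant times the weight to the power `deg f`. -/
theorem exists_dilateError_bound {p : ℕ} {f : MvPolynomial (Fin p) ℂ} {ℓ : (Fin p → ℕ) → ℂ}
    (hexp : ∀ m, Complex.exp (ℓ m) = evalReal f fun i => (m i : ℝ)) {B : ℝ}
    (hB : ∀ m, ‖ℓ m - f.totalDegree * Real.log (natWeight m)‖ ≤ B) :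
    ∃ C : ℝ, ∀ ε m, ‖dilateError f ε m‖ ≤ C / natWeight m := by
  have h1 : ∀ ε : Fin p → Fin 2, ∃ C : ℝ, 0 ≤ C ∧ ∀ m : Fin p → ℕ,
      ‖dilateError f ε m‖ ≤ C / natWeight m := by
    intro ε
    obtain ⟨C, hC, h⟩ := ((DegLE.of_totalDegree f).dilate_sub ε).2.exists_norm_evalReal_le
    refine ⟨C * Real.exp B, by positivity, fun m => ?_⟩
    have hw := natWeight_pos m
    have hlow : natWeight m ^ (f.totalDegree : ℝ) * Real.exp (-B) ≤
        ‖evalReal f fun i => (m i : ℝ)‖ := by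
      rw [← hexp, Complex.norm_exp, Real.rpow_def_of_pos hw, ← Real.exp_add, Real.exp_le_exp]
      have := (Complex.abs_re_le_norm _).trans (hB m)
      have e : (ℓ m - f.totalDegree * Real.log (natWeight m)).re =
          (ℓ m).re - f.totalDegree * Real.log (natWeight m) := by
        rw [Complex.sub_re, ← Complex.ofReal_natCast, ← Complex.ofReal_mul, Complex.ofReal_re]
      rw [e, abs_le] at this
      linarith [this.1]
    have hpos : 0 < natWeight m ^ (f.totalDegree : ℝ) * Real.exp (-B) := by positivity
    have htwo : (1 : ℝ) ≤ 2 ^ f.totalDegree := one_le_pow₀ (by norm_num)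
    rw [dilateError, norm_div, norm_mul, norm_pow, Complex.norm_ofNat]
    have hnum := h _ (natCast_mem_octant m)
    have hsplit : weight (fun i => (m i : ℝ)) ^ (((f.totalDegree : ℤ) - 1 : ℤ) : ℝ) =
        natWeight m ^ (f.totalDegree : ℝ) / natWeight m := by
      change natWeight m ^ _ = _
      push_cast
      rw [Real.rpow_sub hw, Real.rpow_one]
    rw [hsplit] at hnum
    calc _ ≤ (C * (natWeight m ^ (f.totalDegree : ℝ) / natWeight m)) /
          (1 * (natWeight m ^ (f.totalDegree : ℝ) * Real.exp (-B))) := by gcongr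
      _ = C * Real.exp B / natWeight m := by
        rw [Real.exp_neg]
        field_simp
  choose C hC h using h1
  refine ⟨∑ ε, C ε, fun ε m => (h ε m).trans ?_⟩
  have := natWeight_pos m
  gcongr
  exact Finset.single_le_sum (fun ε _ => hC ε) (Finset.mem_univ ε)

theorem natWeight_dilate {p : ℕ} (ε : Fin p → Fin 2) (m : Fin p → ℕ) :
    natWeight (fun i => 2 * m i + (ε i : ℕ)) = 2 * natWeight m - 1 + ∑ i, ((ε i : ℕ) : ℝ) := by
  unfold natWeight weight
  push_cast
  rw [Finset.sum_add_distrib, ← Finset.mul_sum]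
  ring

/-- Far out, `m` and `2m + ε` have nearly the same direction, so a uniformly continuous function on
the simplex hardly distinguishes them. -/
theorem dist_normalized_dilate_le {p : ℕ} (ε : Fin p → Fin 2) (m : Fin p → ℕ) :
    dist ((natWeight fun i => 2 * m i + (ε i : ℕ))⁻¹ •
        fun i => ((2 * m i + (ε i : ℕ) : ℕ) : ℝ)) ((natWeight m)⁻¹ • fun i => (m i : ℝ)) ≤
      (p + 2) / natWeight m := by
  have hw := one_le_natWeight m
  set w' := natWeight fun i => 2 * m i + (ε i : ℕ) with hw'
  set S := ∑ i, ((ε i : ℕ) : ℝ) with hS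
  have hS0 : 0 ≤ S := Finset.sum_nonneg fun _ _ => Nat.cast_nonneg _
  have hε : ∀ i, ((ε i : ℕ) : ℝ) ≤ 1 := fun i => by exact_mod_cast Nat.lt_succ_iff.1 (ε i).2
  have hSp : S ≤ p := by
    calc S ≤ ∑ _i : Fin p, (1 : ℝ) := Finset.sum_le_sum fun i _ => hε i
      _ = p := by simp
  have e : w' = 2 * natWeight m - 1 + S := natWeight_dilate ε m
  have hle : natWeight m ≤ w' := by linarith
  rw [dist_pi_le_iff (by positivity)]
  intro i
  have hmi := one_add_le_natWeight m i
  simp only [Pi.smul_apply, smul_eq_mul, Nat.cast_add, Nat.cast_mul, Nat.cast_ofNat]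
  rw [Real.dist_eq]
  have e2 : w'⁻¹ * (2 * (m i : ℝ) + (ε i : ℕ)) - (natWeight m)⁻¹ * m i =
      (((ε i : ℕ) : ℝ) * natWeight m - m i * (S - 1)) / (w' * natWeight m) := by
    have h1 : w' ≠ 0 := by linarith
    have h2 : natWeight m ≠ 0 := by linarith
    field_simp
    rw [e]
    ring
  rw [e2, abs_div, abs_of_pos (a := w' * natWeight m) (by nlinarith)]
  have hnum : |((ε i : ℕ) : ℝ) * natWeight m - m i * (S - 1)| ≤ (p + 2) * natWeight m := by
    have h0 : (0 : ℝ) ≤ m i := Nat.cast_nonneg _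
    have h0' : (0 : ℝ) ≤ (ε i : ℕ) := Nat.cast_nonneg _
    have h1 := hε i
    have h2 : (m i : ℝ) * S ≤ natWeight m * p := by
      apply mul_le_mul _ hSp hS0 (by linarith)
      linarith
    have h3 : ((ε i : ℕ) : ℝ) * natWeight m ≤ 1 * natWeight m := by gcongr
    have h4 : 0 ≤ ((ε i : ℕ) : ℝ) * natWeight m := by positivity
    have h5 : 0 ≤ (m i : ℝ) * S := by positivity
    have h6 : (0 : ℝ) ≤ p * natWeight m := by positivity
    rw [abs_le]
    constructor <;> nlinarith
  calc _ ≤ ((p + 2) * natWeight m) / (natWeight m * natWeight m) := by gcongr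
    _ = (p + 2) / natWeight m := by field_simp

/-- The branch is `deg f * log (weight x) + L (x / weight x)`, with `L` a continuous logarithm of
the homogenization on the compact simplex. Boundedness of `L` gives the growth estimate, and its
uniform continuity the compatibility with dilation. -/
theorem MahlerHypothesis.exists_isLogBranch {p : ℕ} {f : MvPolynomial (Fin p) ℂ}
    (hf : MahlerHypothesis f) :
    ∃ ℓ : (Fin p → ℝ) → ℂ, IsLogBranch f ℓ ∧ IsLatticeLog f fun m => ℓ fun i => (m i : ℝ) := by
  obtain ⟨L, hLc, hL⟩ := (convex_cornerSimplex p).exists_continuousOn_exp_eq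
    ⟨0, fun i => le_rfl, by simp⟩ (continuous_homogenizedEval f).continuousOn
    fun y hy => hf.homogenizedEval_ne_zero hy
  have hKc := isCompact_cornerSimplex p
  set ℓ : (Fin p → ℝ) → ℂ := fun x => f.totalDegree * Real.log (weight x) + L ((weight x)⁻¹ • x)
    with hℓ
  have hwc : Continuous (weight : (Fin p → ℝ) → ℝ) :=
    continuous_const.add (continuous_finsetSum _ fun i _ => continuous_apply i)
  have hbranch : IsLogBranch f ℓ := by
    constructor
    · have hne : ∀ x ∈ octant p, weight x ≠ 0 := fun x hx => by linarith [one_le_weight hx]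
      refine ContinuousOn.add (continuousOn_const.mul (Complex.continuous_ofReal.comp_continuousOn
        (hwc.continuousOn.log hne))) ?_
      exact hLc.comp ((hwc.continuousOn.inv₀ hne).smul continuousOn_id)
        fun x hx => inv_weight_smul_mem_cornerSimplex hx
    · intro x hx
      have hw : 0 < weight x := by linarith [one_le_weight hx]
      have hw' : (weight x : ℂ) ≠ 0 := by exact_mod_cast hw.ne'
      rw [hℓ]
      simp only
      rw [Complex.exp_add, hL _ (inv_weight_smul_mem_cornerSimplex hx), homogenizedEval_eq,
        Complex.exp_nat_mul, ← Complex.ofReal_exp, Real.exp_log hw, ← mul_assoc, ← mul_pow,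
        Complex.ofReal_inv, mul_inv_cancel₀ hw', one_pow, one_mul]
      rw [← Finset.mul_sum]
      have : ∑ i, x i = weight x - 1 := by unfold weight; ring
      rw [this]
      field_simp
      ring
  refine ⟨ℓ, hbranch, ?_⟩
  have hexp : ∀ m : Fin p → ℕ, Complex.exp (ℓ fun i => (m i : ℝ)) = evalReal f fun i => (m i : ℝ) :=
    fun m => hbranch.exp_eq _ (natCast_mem_octant m)
  obtain ⟨B, hB⟩ := hKc.exists_bound_of_continuousOn hLc
  have hbound : ∀ m : Fin p → ℕ,
      ‖ℓ (fun i => (m i : ℝ)) - f.totalDegree * Real.log (natWeight m)‖ ≤ B := by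
    intro m
    have := hB _ (inv_weight_smul_mem_cornerSimplex (natCast_mem_octant m))
    simpa [hℓ, natWeight] using this
  obtain ⟨C, hC⟩ := exists_dilateError_bound hexp hbound
  refine ⟨hexp, ⟨B, hbound⟩, ⟨C, hC⟩, fun ε => ?_⟩
  have hinv : ∀ a : ℝ, Tendsto (fun m : Fin p → ℕ => a / natWeight m) cofinite (𝓝 0) := fun a =>
    tendsto_natWeight_atTop.const_div_atTop a
  have hu : Tendsto (fun m : Fin p → ℕ => dilateError f ε m) cofinite (𝓝 0) :=
    squeeze_zero_norm (fun m => hC ε m) (hinv C)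
  have h1 : ∀ᶠ m : Fin p → ℕ in cofinite, ‖Complex.log (1 + dilateError f ε m)‖ < 1 := by
    have : Tendsto (fun m : Fin p → ℕ => Complex.log (1 + dilateError f ε m)) cofinite (𝓝 0) := by
      have h := ((continuousAt_clog (x := 1 + 0) (by simp)).tendsto.comp (hu.const_add 1))
      simpa [Function.comp_def] using h
    simpa using this.norm.eventually_lt_const (by simp)
  have h2 : ∀ᶠ m : Fin p → ℕ in cofinite,
      ‖(f.totalDegree : ℂ) * (Real.log (natWeight (fun i => 2 * m i + (ε i : ℕ)) /
        (2 * natWeight m)) : ℝ)‖ < 1 := by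
    have hr : Tendsto (fun m : Fin p → ℕ => natWeight (fun i => 2 * m i + (ε i : ℕ)) /
        (2 * natWeight m)) cofinite (𝓝 1) := by
      have := (hinv ((∑ i, ((ε i : ℕ) : ℝ) - 1) / 2)).const_add 1
      rw [add_zero] at this
      refine this.congr fun m => ?_
      have := (natWeight_pos m).ne'
      rw [natWeight_dilate]
      field_simp
      ring
    have h := ((Complex.continuous_ofReal.tendsto _).comp
      ((Real.continuousAt_log one_ne_zero).tendsto.comp hr)).const_mul (f.totalDegree : ℂ)
    simp only [Real.log_one, Complex.ofReal_zero, mul_zero] at h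
    simpa using h.norm.eventually_lt_const (by simp)
  have h3 : ∀ᶠ m : Fin p → ℕ in cofinite,
      ‖L ((natWeight fun i => 2 * m i + (ε i : ℕ))⁻¹ • fun i => ((2 * m i + (ε i : ℕ) : ℕ) : ℝ)) -
        L ((natWeight m)⁻¹ • fun i => (m i : ℝ))‖ < 1 := by
    obtain ⟨δ, hδ, h⟩ := Metric.uniformContinuousOn_iff.1
      (hKc.uniformContinuousOn_of_continuous hLc) 1 one_pos
    filter_upwards [(hinv (p + 2)).eventually_lt_const hδ] with m hm
    rw [← dist_eq_norm]
    exact h _ (inv_weight_smul_mem_cornerSimplex (natCast_mem_octant _)) _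
      (inv_weight_smul_mem_cornerSimplex (natCast_mem_octant _))
      ((dist_normalized_dilate_le ε m).trans_lt hm)
  filter_upwards [h1, h2, h3] with m hm1 hm2 hm3
  have hw := natWeight_pos m
  have hw' := natWeight_pos fun i => 2 * m i + (ε i : ℕ)
  have hf0 : evalReal f (fun i => (m i : ℝ)) ≠ 0 := hf.ne_zero _ (natCast_mem_octant m)
  have hcast : (fun i => ((2 * m i + (ε i : ℕ) : ℕ) : ℝ)) =
      fun i => 2 * (m i : ℝ) + ((ε i : ℕ) : ℝ) := by
    funext i
    push_cast
    rfl
  have hone : 1 + dilateError f ε m = evalReal f (fun i => ((2 * m i + (ε i : ℕ) : ℕ) : ℝ)) /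
      ((2 : ℂ) ^ f.totalDegree * evalReal f fun i => (m i : ℝ)) := by
    have h2d : (2 : ℂ) ^ f.totalDegree ≠ 0 := pow_ne_zero _ two_ne_zero
    have hr : evalReal (dilate ε f - MvPolynomial.C ((2 : ℂ) ^ (f.totalDegree : ℤ)) * f)
        (fun i => (m i : ℝ)) = evalReal (dilate ε f) (fun i => (m i : ℝ)) -
          2 ^ f.totalDegree * evalReal f fun i => (m i : ℝ) := by
      simp [evalReal]
    rw [dilateError, hr, evalReal_dilate, hcast]
    field_simp
    ring
  have hone_ne : 1 + dilateError f ε m ≠ 0 := by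
    rw [hone]
    exact div_ne_zero (hf.ne_zero _ (natCast_mem_octant _))
      (mul_ne_zero (pow_ne_zero _ two_ne_zero) hf0)
  -- The discrepancy `Φ` is an integer multiple of 2πi. It is made up of three pieces of norm below
  -- 1, and 3 < 2π, so it vanishes.
  set Φ := ℓ (fun i => ((2 * m i + (ε i : ℕ) : ℕ) : ℝ)) - (ℓ (fun i => (m i : ℝ)) +
    f.totalDegree * Complex.log 2 + Complex.log (1 + dilateError f ε m)) with hΦ
  have hΦexp : Complex.exp Φ = 1 := by
    rw [hΦ, Complex.exp_sub, hexp fun i => 2 * m i + (ε i : ℕ),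
      Complex.exp_add _ (Complex.log _), Complex.exp_add (ℓ fun i => (m i : ℝ)), hexp m, Complex.exp_log hone_ne, Complex.exp_nat_mul,
      Complex.exp_log two_ne_zero, hone]
    have := hf.ne_zero _ (natCast_mem_octant fun i => 2 * m i + (ε i : ℕ))
    field_simp
  have hΦlt : ‖Φ‖ < 3 := by
    have e : Φ = (f.totalDegree : ℂ) * (Real.log (natWeight (fun i => 2 * m i + (ε i : ℕ)) /
        (2 * natWeight m)) : ℝ) +
        (L ((natWeight fun i => 2 * m i + (ε i : ℕ))⁻¹ •
          fun i => ((2 * m i + (ε i : ℕ) : ℕ) : ℝ)) - L ((natWeight m)⁻¹ • fun i => (m i : ℝ))) -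
        Complex.log (1 + dilateError f ε m) := by
      have hlog2 : Complex.log 2 = (Real.log 2 : ℝ) := by
        rw [Complex.ofReal_log (by norm_num)]
        norm_num
      rw [Real.log_div hw'.ne' (by positivity), Real.log_mul two_ne_zero hw.ne', hΦ, hℓ, hlog2]
      simp only [natWeight]
      push_cast
      ring
    rw [e]
    refine (norm_sub_le _ _).trans_lt ?_
    have := norm_add_le ((f.totalDegree : ℂ) * (Real.log (natWeight (fun i => 2 * m i + (ε i : ℕ)) /
        (2 * natWeight m)) : ℝ)) (L ((natWeight fun i => 2 * m i + (ε i : ℕ))⁻¹ •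
          fun i => ((2 * m i + (ε i : ℕ) : ℕ) : ℝ)) - L ((natWeight m)⁻¹ • fun i => (m i : ℝ)))
    linarith
  obtain ⟨n, hn⟩ := Complex.exp_eq_one_iff.1 hΦexp
  have hn0 : n = 0 := by
    by_contra hne
    have h1 : (1 : ℝ) ≤ |(n : ℝ)| := by exact_mod_cast Int.one_le_abs hne
    rw [hn, norm_mul, Complex.norm_intCast] at hΦlt
    have h2 : ‖(2 * Real.pi * Complex.I : ℂ)‖ = 2 * Real.pi := by
      simp [abs_of_pos Real.pi_pos]
    rw [h2] at hΦlt
    nlinarith [Real.pi_gt_three]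
  rw [hn0] at hn
  simp only [Int.cast_zero, zero_mul] at hn
  exact sub_eq_zero.1 hn

/-! ### The multivariable series and its binomial expansion -/

/-- The finitely many terms that escape the bound `u` are locally bounded by continuity, so
enlarging `u` there restores domination. -/
theorem differentiableAt_tsum_of_eventually_norm_le {α E : Type*} [NormedAddCommGroup E]
    [NormedSpace ℂ E] {u : α → ℝ} {F : α → E → ℂ} {x : E} {r : ℝ} (hr : 0 < r) (hu : Summable u)
    (hu0 : ∀ k, 0 ≤ u k) (hF : ∀ k, Differentiable ℂ (F k))
    (hb : ∀ᶠ k in cofinite, ∀ y ∈ Metric.ball x r, ‖F k y‖ ≤ u k) :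
    Summable (fun k => F k x) ∧ DifferentiableAt ℂ (fun y => ∑' k, F k y) x := by
  classical
  set S := (show Set.Finite {k | ¬ ∀ y ∈ Metric.ball x r, ‖F k y‖ ≤ u k} from hb).toFinset with hS
  have hloc : ∀ᶠ y in 𝓝 x, ∀ k ∈ S, ‖F k y‖ < ‖F k x‖ + 1 := by
    rw [eventually_all_finset]
    intro k _
    exact (hF k).continuous.norm.tendsto x |>.eventually_lt_const (by linarith)
  obtain ⟨r', hr', hball⟩ := Metric.eventually_nhds_iff_ball.1 hloc
  have hsum : Summable fun k => u k + if k ∈ S then ‖F k x‖ + 1 else 0 :=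
    hu.add (summable_of_ne_finset_zero (s := S) fun k hk => by simp [hk])
  have hbound : ∀ k, ∀ y ∈ Metric.ball x (min r r'),
      ‖F k y‖ ≤ u k + if k ∈ S then ‖F k x‖ + 1 else 0 := by
    intro k y hy
    by_cases hk : k ∈ S
    · have := hball y (Metric.ball_subset_ball (min_le_right _ _) hy) k hk
      have := hu0 k
      rw [if_pos hk]
      linarith
    · rw [if_neg hk, add_zero]
      have : ∀ y ∈ Metric.ball x r, ‖F k y‖ ≤ u k := by simpa [hS] using hk
      exact this y (Metric.ball_subset_ball (min_le_left _ _) hy)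
  have hmin : 0 < min r r' := lt_min hr hr'
  exact ⟨Summable.of_norm_bounded hsum fun k => hbound k x (Metric.mem_ball_self hmin),
    differentiableAt_tsum_of_norm_le hmin hsum (fun k => (hF k).differentiableOn) hbound⟩

section Recursion

variable {p : ℕ} {ι : Type*} [Fintype ι]

/-- The linear form `s ↦ ∑ deg(f_j) s_j`. -/
noncomputable def degForm (f : ι → MvPolynomial (Fin p) ℂ) (s : ι → ℂ) : ℂ :=
  ∑ j, ((f j).totalDegree : ℂ) * s j

/-- The function `s ↦ 2 ^ (-∑ deg(f_j) s_j)`. -/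
noncomputable def dyadicFactor (f : ι → MvPolynomial (Fin p) ℂ) (s : ι → ℂ) : ℂ :=
  Complex.exp (-(degForm f s * Complex.log 2))

/-- The term `P(k) ∏ f_j(k)^{-s_j}`, where `ℓ_j` is a logarithm of `f_j`. -/
noncomputable def multiTerm (ℓ : ι → (Fin p → ℕ) → ℂ) (P : MvPolynomial (Fin p) ℂ) (s : ι → ℂ)
    (k : Fin p → ℕ) : ℂ :=
  evalReal P (fun i => (k i : ℝ)) * Complex.exp (-∑ j, s j * ℓ j k)

theorem differentiable_degForm (f : ι → MvPolynomial (Fin p) ℂ) :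
    Differentiable ℂ (degForm f) := by
  unfold degForm
  fun_prop

theorem differentiable_dyadicFactor (f : ι → MvPolynomial (Fin p) ℂ) :
    Differentiable ℂ (dyadicFactor f) := by
  unfold dyadicFactor
  exact ((differentiable_degForm f).mul_const _).neg.cexp

theorem differentiable_multiTerm (ℓ : ι → (Fin p → ℕ) → ℂ) (P : MvPolynomial (Fin p) ℂ)
    (k : Fin p → ℕ) : Differentiable ℂ fun s => multiTerm ℓ P s k := by
  unfold multiTerm
  fun_prop

variable {f : ι → MvPolynomial (Fin p) ℂ} {ℓ : ι → (Fin p → ℕ) → ℂ}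

theorem exists_norm_exp_neg_sum_le (hℓ : ∀ j, IsLatticeLog (f j) (ℓ j)) (R : ℝ) :
    ∃ B : ℝ, 0 ≤ B ∧ ∀ s : ι → ℂ, ‖s‖ ≤ R → ∀ k,
      ‖Complex.exp (-∑ j, s j * ℓ j k)‖ ≤ B * natWeight k ^ (-(degForm f s).re) := by
  choose b hb using fun j => (hℓ j).bound
  refine ⟨Real.exp (∑ j, R * b j), (Real.exp_pos _).le, fun s hs k => ?_⟩
  have e : -∑ j, s j * ℓ j k = -(degForm f s * (Real.log (natWeight k) : ℝ)) -
      ∑ j, s j * (ℓ j k - (f j).totalDegree * Real.log (natWeight k)) := by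
    simp only [degForm, mul_sub, Finset.sum_sub_distrib, Finset.sum_mul]
    rw [← sub_eq_zero]
    have : ∀ j, s j * ((f j).totalDegree * (Real.log (natWeight k) : ℂ)) =
        (f j).totalDegree * s j * (Real.log (natWeight k) : ℂ) := fun j => by ring
    simp only [this]
    ring
  rw [Complex.norm_exp, e, Real.rpow_def_of_pos (natWeight_pos k), ← Real.exp_add, Real.exp_le_exp,
    Complex.sub_re, Complex.neg_re, Complex.re_mul_ofReal]
  have h1 : ‖∑ j, s j * (ℓ j k - (f j).totalDegree * Real.log (natWeight k))‖ ≤ ∑ j, R * b j := by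
    refine norm_sum_le_of_le _ fun j _ => ?_
    rw [norm_mul]
    exact mul_le_mul ((norm_le_pi_norm s j).trans hs) (hb j k) (norm_nonneg _)
      ((norm_nonneg _).trans hs)
  have h2 := (abs_le.1 ((Complex.abs_re_le_norm _).trans h1)).1
  linarith

/-- Near `s₀` the terms are dominated by a power of the weight that is as close as desired to the
expected one. -/
theorem exists_ball_norm_le (hℓ : ∀ j, IsLatticeLog (f j) (ℓ j)) {P : MvPolynomial (Fin p) ℂ}
    {b : ℤ} (hP : DegLE P b) (s₀ : ι → ℂ) {η : ℝ} (hη : 0 < η) :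
    ∃ r : ℝ, 0 < r ∧ ∃ C : ℝ, 0 ≤ C ∧ ∀ s ∈ Metric.ball s₀ r, ∀ k,
      ‖multiTerm ℓ P s k‖ ≤ C * natWeight k ^ ((b : ℝ) - (degForm f s₀).re + η) := by
  obtain ⟨C, hC, h⟩ := hP.exists_norm_evalReal_le
  obtain ⟨B, hB, h'⟩ := exists_norm_exp_neg_sum_le hℓ (‖s₀‖ + 1)
  have hcont : Continuous fun s => (degForm f s).re :=
    Complex.continuous_re.comp (differentiable_degForm f).continuous
  obtain ⟨r, hr, hball⟩ := Metric.eventually_nhds_iff_ball.1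
    ((hcont.tendsto s₀).eventually_const_lt (show (degForm f s₀).re - η < (degForm f s₀).re by
      linarith))
  refine ⟨min r 1, lt_min hr one_pos, C * B, by positivity, fun s hs k => ?_⟩
  have h1 := hball s (Metric.ball_subset_ball (min_le_left _ _) hs)
  have h2 : ‖s‖ ≤ ‖s₀‖ + 1 := by
    have h3 := Metric.mem_ball.1 (Metric.ball_subset_ball (min_le_right _ _) hs)
    rw [dist_eq_norm] at h3
    have := norm_le_norm_add_norm_sub' s s₀
    linarith
  rw [multiTerm, norm_mul]
  have hw := one_le_natWeight k
  calc _ ≤ (C * natWeight k ^ (b : ℝ)) * (B * natWeight k ^ (-(degForm f s).re)) :=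
        mul_le_mul (h _ (natCast_mem_octant k)) (h' s h2 k) (norm_nonneg _)
          (mul_nonneg hC (Real.rpow_nonneg (natWeight_pos k).le _))
    _ = C * B * natWeight k ^ ((b : ℝ) - (degForm f s).re) := by
        rw [sub_eq_add_neg, Real.rpow_add (natWeight_pos k)]
        ring
    _ ≤ _ := by
        refine mul_le_mul_of_nonneg_left ?_ (by positivity)
        exact Real.rpow_le_rpow_of_exponent_le hw (by linarith)

theorem summable_differentiableAt_multiTerm (hℓ : ∀ j, IsLatticeLog (f j) (ℓ j))
    {P : MvPolynomial (Fin p) ℂ} {b : ℤ} (hP : DegLE P b) {s : ι → ℂ}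
    (hs : (b : ℝ) + p < (degForm f s).re) :
    Summable (multiTerm ℓ P s) ∧
      DifferentiableAt ℂ (fun s => ∑' k, multiTerm ℓ P s k) s := by
  -- Half of the gap to the boundary of convergence is given up, so the exponent stays below `-p`.
  obtain ⟨r, hr, C, hC, h⟩ := exists_ball_norm_le hℓ hP s
    (η := ((degForm f s).re - b - p) / 2) (by linarith)
  refine differentiableAt_tsum_of_eventually_norm_le hr
    ((summable_natWeight_rpow (p := p) ?_).mul_left C)
    (fun k => mul_nonneg hC (Real.rpow_nonneg (natWeight_pos k).le _))
    (differentiable_multiTerm ℓ P) (Eventually.of_forall fun k s hs => h s hs k)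
  linarith

/-- The polynomial `f_j(2x + ε) - 2 ^ deg(f_j) f_j(x)`. -/
noncomputable def dilateDiff (f : MvPolynomial (Fin p) ℂ) (ε : Fin p → Fin 2) :
    MvPolynomial (Fin p) ℂ :=
  dilate ε f - MvPolynomial.C ((2 : ℂ) ^ (f.totalDegree : ℤ)) * f

/-- The coefficient of `∏ (f_j(2x + ε) - 2 ^ deg(f_j) f_j(x)) ^ l_j` in the binomial expansion of
`∏ f_j(2x + ε) ^ (-s_j)`. -/
noncomputable def dilateCoeff (f : ι → MvPolynomial (Fin p) ℂ) (l : ι → ℕ) (s : ι → ℂ) : ℂ :=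
  ∏ j, negBinom (l j) (s j) * ((2 : ℂ) ^ (f j).totalDegree)⁻¹ ^ l j

theorem differentiable_dilateCoeff (f : ι → MvPolynomial (Fin p) ℂ) (l : ι → ℕ) :
    Differentiable ℂ (dilateCoeff f l) := by
  classical
  unfold dilateCoeff
  induction (Finset.univ : Finset ι) using Finset.induction_on with
  | empty => simp
  | insert j t hj ih =>
    simp only [Finset.prod_insert hj]
    have h : Differentiable ℂ fun s : ι → ℂ => negBinom (l j) (s j) :=
      (differentiable_negBinom (l j)).comp (differentiable_apply j)
    exact (h.mul_const _).mul ih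

/-- A binomial coefficient of positive order in the exponent `-s` contains the factor `-s`. -/
theorem dilateCoeff_apply_zero {l : ι → ℕ} (hl : l ≠ 0) : dilateCoeff f l 0 = 0 := by
  obtain ⟨j, hj⟩ := Function.ne_iff.1 hl
  refine Finset.prod_eq_zero (Finset.mem_univ j) ?_
  obtain ⟨k, hk⟩ := Nat.exists_eq_succ_of_ne_zero hj
  rw [hk, Pi.zero_apply, negBinom_succ_zero, zero_mul]

theorem dilateCoeff_zero (s : ι → ℂ) : dilateCoeff f 0 s = 1 := by
  simp [dilateCoeff, negBinom]

variable [DecidableEq ι]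

/-- The multi-indices with all entries less than `N`. -/
def indexBox (ι : Type*) [Fintype ι] [DecidableEq ι] (N : ℕ) : Finset (ι → ℕ) :=
  Fintype.piFinset fun _ => Finset.range N

/-- The polynomial part of the terms of the binomial expansion. -/
noncomputable def dilateMonomial (f : ι → MvPolynomial (Fin p) ℂ) (P : MvPolynomial (Fin p) ℂ)
    (ε : Fin p → Fin 2) (l : ι → ℕ) : MvPolynomial (Fin p) ℂ :=
  dilate ε P * ∏ j, dilateDiff (f j) ε ^ l j

/-- The remainder of the binomial expansion of the term at `2m + ε`. -/
noncomputable def dilateRemainder (f : ι → MvPolynomial (Fin p) ℂ) (ℓ : ι → (Fin p → ℕ) → ℂ)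
    (N : ℕ) (P : MvPolynomial (Fin p) ℂ) (ε : Fin p → Fin 2) (s : ι → ℂ) (m : Fin p → ℕ) : ℂ :=
  multiTerm ℓ P s (fun i => 2 * m i + (ε i : ℕ)) - dyadicFactor f s * ∑ l ∈ indexBox ι N,
    dilateCoeff f l s * multiTerm ℓ (dilateMonomial f P ε l) (fun j => s j + l j) m

/-- The shift `s + l` absorbs the denominators `f_j ^ l_j` of the relative errors; this is what
makes every term of the expansion a term of a series of the same kind. -/
theorem sum_dilateCoeff_mul (hℓ : ∀ j, IsLatticeLog (f j) (ℓ j)) (N : ℕ)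
    (P : MvPolynomial (Fin p) ℂ) (ε : Fin p → Fin 2) (s : ι → ℂ) (m : Fin p → ℕ) :
    ∑ l ∈ indexBox ι N,
      dilateCoeff f l s * multiTerm ℓ (dilateMonomial f P ε l) (fun j => s j + l j) m =
    multiTerm ℓ (dilate ε P) s m *
      ∏ j, ∑ l ∈ Finset.range N, negBinom l (s j) * dilateError (f j) ε m ^ l := by
  rw [Finset.prod_univ_sum, Finset.mul_sum]
  refine Finset.sum_congr rfl fun l _ => ?_
  have h1 : Complex.exp (-∑ j, (s j + l j) * ℓ j m) =
      Complex.exp (-∑ j, s j * ℓ j m) * ∏ j, (evalReal (f j) fun i => (m i : ℝ))⁻¹ ^ l j := by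
    simp only [add_mul, Finset.sum_add_distrib, neg_add, Complex.exp_add]
    congr 1
    rw [← Finset.sum_neg_distrib, Complex.exp_sum]
    refine Finset.prod_congr rfl fun j _ => ?_
    rw [Complex.exp_neg, Complex.exp_nat_mul, (hℓ j).exp_eq, inv_pow]
  have h2 : evalReal (dilateMonomial f P ε l) (fun i => (m i : ℝ)) =
      evalReal (dilate ε P) (fun i => (m i : ℝ)) *
        ∏ j, evalReal (dilateDiff (f j) ε) (fun i => (m i : ℝ)) ^ l j := by
    simp [dilateMonomial, evalReal, map_mul, map_prod, map_pow]
  have h3 : ∀ j, dilateError (f j) ε m ^ l j =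
      evalReal (dilateDiff (f j) ε) (fun i => (m i : ℝ)) ^ l j *
        ((evalReal (f j) fun i => (m i : ℝ))⁻¹ ^ l j * ((2 : ℂ) ^ (f j).totalDegree)⁻¹ ^ l j) := by
    intro j
    rw [← mul_pow, ← mul_pow, dilateError, dilateDiff, div_eq_mul_inv, mul_inv_rev]
  rw [multiTerm, multiTerm, h1, h2, dilateCoeff]
  simp only [h3, Finset.prod_mul_distrib]
  ring

/-- The branch identity fails for at most finitely many `m`, and this exceptional set does not
depend on `s`. -/
theorem eventually_dilateRemainder_eq (hℓ : ∀ j, IsLatticeLog (f j) (ℓ j)) (N : ℕ)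
    (P : MvPolynomial (Fin p) ℂ) (ε : Fin p → Fin 2) :
    ∀ᶠ m in cofinite, ∀ s : ι → ℂ, dilateRemainder f ℓ N P ε s m =
      dyadicFactor f s * multiTerm ℓ (dilate ε P) s m *
        (∏ j, Complex.exp (-s j * Complex.log (1 + dilateError (f j) ε m)) -
          ∏ j, ∑ l ∈ Finset.range N, negBinom l (s j) * dilateError (f j) ε m ^ l) := by
  filter_upwards [eventually_all.2 fun j => (hℓ j).dilate_eq ε] with m hm s
  rw [dilateRemainder, sum_dilateCoeff_mul hℓ, mul_sub, ← mul_assoc]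
  congr 1
  rw [multiTerm, multiTerm, evalReal_dilate, dyadicFactor, degForm, ← Complex.exp_sum]
  have hcast : (fun i => ((2 * m i + (ε i : ℕ) : ℕ) : ℝ)) =
      fun i => 2 * (m i : ℝ) + ((ε i : ℕ) : ℝ) := by
    funext i
    push_cast
    rfl
  rw [hcast, mul_left_comm, mul_assoc, ← Complex.exp_add, ← Complex.exp_add]
  congr 2
  simp only [hm, Finset.sum_mul, ← Finset.sum_neg_distrib, ← Finset.sum_add_distrib]
  refine Finset.sum_congr rfl fun j _ => ?_
  ring

theorem differentiable_dilateRemainder (N : ℕ) (P : MvPolynomial (Fin p) ℂ) (ε : Fin p → Fin 2)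
    (m : Fin p → ℕ) : Differentiable ℂ fun s => dilateRemainder f ℓ N P ε s m := by
  unfold dilateRemainder
  refine (differentiable_multiTerm ℓ P _).sub ((differentiable_dyadicFactor f).mul
    (Differentiable.fun_sum fun l _ => (differentiable_dilateCoeff f l).mul ?_))
  exact (differentiable_multiTerm ℓ _ m).comp
    (differentiable_id.add_const fun j => (l j : ℂ))

theorem exists_norm_prod_cpow_sub_le (ι : Type*) [Fintype ι] (N : ℕ) (R : ℝ) :
    ∃ A : ℝ, 0 ≤ A ∧ ∀ (s u : ι → ℂ) (δ : ℝ), ‖s‖ ≤ R → (∀ j, ‖u j‖ ≤ δ) → δ ≤ 1 / 2 →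
      ‖∏ j, Complex.exp (-s j * Complex.log (1 + u j)) -
        ∏ j, ∑ l ∈ Finset.range N, negBinom l (s j) * u j ^ l‖ ≤ A * δ ^ N := by
  obtain ⟨D, hD, hbin⟩ := exists_norm_one_add_cpow_sub_le N |R|
  set K := Real.exp |R| + D with hK
  have hK1 : 1 ≤ K := by
    have := Real.one_le_exp (abs_nonneg R)
    linarith
  set n := (Finset.univ : Finset ι).card
  refine ⟨n * K ^ n * D, by positivity, fun s u δ hs hu hδ => ?_⟩
  have hs' : ∀ j, ‖s j‖ ≤ |R| := fun j => (norm_le_pi_norm s j).trans (hs.trans (le_abs_self R))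
  have hexpb : ∀ j, ‖Complex.exp (-s j * Complex.log (1 + u j))‖ ≤ Real.exp |R| := by
    intro j
    refine (Complex.norm_exp_le_exp_norm _).trans (Real.exp_le_exp.2 ?_)
    have hlog : ‖Complex.log (1 + u j)‖ ≤ 1 := by
      have := Complex.norm_log_one_add_half_le_self ((hu j).trans hδ)
      linarith [hu j]
    rw [norm_mul, norm_neg]
    calc _ ≤ |R| * 1 := mul_le_mul (hs' j) hlog (norm_nonneg _) (abs_nonneg R)
      _ = _ := mul_one _
  have hdiff : ∀ j, ‖Complex.exp (-s j * Complex.log (1 + u j)) -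
      ∑ l ∈ Finset.range N, negBinom l (s j) * u j ^ l‖ ≤ D * ‖u j‖ ^ N :=
    fun j => hbin (s j) (u j) (hs' j) ((hu j).trans hδ)
  rw [mul_assoc]
  refine norm_prod_sub_prod_le_of_norm_le Finset.univ hK1 (fun j _ => (hexpb j).trans (by linarith))
    (fun j _ => ?_) (fun j _ => (hdiff j).trans ?_)
  · have e := norm_sub_norm_le (∑ l ∈ Finset.range N, negBinom l (s j) * u j ^ l)
      (Complex.exp (-s j * Complex.log (1 + u j)))
    rw [norm_sub_rev] at e
    have h3 : D * ‖u j‖ ^ N ≤ D * 1 := by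
      gcongr
      exact pow_le_one₀ (norm_nonneg _) ((hu j).trans (hδ.trans (by norm_num)))
    linarith [hdiff j, hexpb j]
  · gcongr
    exact hu j

/-- Truncating at order `N` makes the remainder smaller than the term itself by the factor
`natWeight m ^ (-N)`, so the half space of convergence grows by `N`. -/
theorem summable_differentiableAt_dilateRemainder (hℓ : ∀ j, IsLatticeLog (f j) (ℓ j)) (N : ℕ)
    {P : MvPolynomial (Fin p) ℂ} {b : ℤ} (hP : DegLE P b) (ε : Fin p → Fin 2) {s₀ : ι → ℂ}
    (hs : (b : ℝ) + p - N < (degForm f s₀).re) :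
    Summable (dilateRemainder f ℓ N P ε s₀) ∧
      DifferentiableAt ℂ (fun s => ∑' m, dilateRemainder f ℓ N P ε s m) s₀ := by
  obtain ⟨r, hr, C, hC, h⟩ := exists_ball_norm_le hℓ (hP.dilate_sub ε).1 s₀
    (η := ((degForm f s₀).re - b - p + N) / 2) (by linarith)
  obtain ⟨r', hr', hq⟩ := Metric.eventually_nhds_iff_ball.1
    (((differentiable_dyadicFactor f).continuous.norm.tendsto s₀).eventually_lt_const
      (lt_add_one _))
  choose c hc using fun j => (hℓ j).error_bound
  obtain ⟨c', hc'⟩ : ∃ c', c' = 1 + ∑ j, |c j| := ⟨_, rfl⟩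
  have hc'pos : 0 < c' := by
    have : 0 ≤ ∑ j, |c j| := Finset.sum_nonneg fun j _ => abs_nonneg _
    linarith
  have herr : ∀ j m, ‖dilateError (f j) ε m‖ ≤ c' / natWeight m := by
    intro j m
    have hw := natWeight_pos m
    refine (hc j ε m).trans ?_
    gcongr
    have := Finset.single_le_sum (f := fun j => |c j|) (fun j _ => abs_nonneg _) (Finset.mem_univ j)
    linarith [le_abs_self (c j)]
  obtain ⟨A, hA, hprod⟩ := exists_norm_prod_cpow_sub_le ι N (‖s₀‖ + 1)
  obtain ⟨q, hqdef⟩ : ∃ q, q = ‖dyadicFactor f s₀‖ + 1 := ⟨_, rfl⟩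
  obtain ⟨α, hα⟩ : ∃ α, α = (b : ℝ) - (degForm f s₀).re + ((degForm f s₀).re - b - p + N) / 2 :=
    ⟨_, rfl⟩
  rw [← hqdef] at hq
  rw [← hα] at h
  have hq0 : 0 ≤ q := by rw [hqdef]; positivity
  have hαp : α - N < -p := by rw [hα]; linarith
  clear hα hqdef hP hs
  refine differentiableAt_tsum_of_eventually_norm_le (r := min (min r r') 1)
    (F := fun m s => dilateRemainder f ℓ N P ε s m)
    (lt_min (lt_min hr hr') one_pos)
    (u := fun m => q * C * (A * c' ^ N) * natWeight m ^ (α - N))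
    ((summable_natWeight_rpow hαp).mul_left _)
    (fun m => mul_nonneg (by positivity) (Real.rpow_nonneg (natWeight_pos m).le _))
    (differentiable_dilateRemainder N P ε) ?_
  -- Weight at least `2 * c'` forces the relative errors to be at most 1/2, as the binomial estimate
  -- requires.
  filter_upwards [eventually_dilateRemainder_eq hℓ N P ε,
    tendsto_natWeight_atTop.eventually_ge_atTop (2 * c')] with m hm hmw s hsball
  have hw := natWeight_pos m
  have hs1 : ‖s‖ ≤ ‖s₀‖ + 1 := by
    have h3 := Metric.mem_ball.1 (Metric.ball_subset_ball (min_le_right _ _) hsball)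
    rw [dist_eq_norm] at h3
    have := norm_le_norm_add_norm_sub' s s₀
    linarith
  have hball' := Metric.ball_subset_ball (min_le_left _ _) hsball
  have h1 := h s (Metric.ball_subset_ball (min_le_left _ _) hball') m
  have h2 := hq s (Metric.ball_subset_ball (min_le_right _ _) hball')
  have h3 := hprod s (fun j => dilateError (f j) ε m) (c' / natWeight m) hs1 (fun j => herr j m)
    (by rw [div_le_div_iff₀ hw two_pos]; linarith)
  rw [hm s, norm_mul, norm_mul]
  have h4 : 0 ≤ natWeight m ^ α := Real.rpow_nonneg hw.le _
  calc _ ≤ (q * (C * natWeight m ^ α)) * (A * (c' / natWeight m) ^ N) :=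
        mul_le_mul (mul_le_mul h2.le h1 (norm_nonneg _) hq0) h3 (norm_nonneg _)
          (mul_nonneg hq0 (mul_nonneg hC h4))
    _ = _ := by
        rw [Real.rpow_sub hw, Real.rpow_natCast, div_pow]
        ring

end Recursion

/-! ### Dyadic functional equation and continuation -/

/-- Division with remainder by `2` in every coordinate. -/
def dyadicEquiv (p : ℕ) : (Fin p → Fin 2) × (Fin p → ℕ) ≃ (Fin p → ℕ) :=
  (Equiv.prodComm _ _).trans ((Equiv.arrowProdEquivProdArrow (Fin p) (fun _ => ℕ)
    fun _ => Fin 2).symm.trans (Equiv.piCongrRight fun _ => (Nat.divModEquiv 2).symm))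

theorem dyadicEquiv_apply {p : ℕ} (ε : Fin p → Fin 2) (m : Fin p → ℕ) :
    dyadicEquiv p (ε, m) = fun i => 2 * m i + (ε i : ℕ) := by
  funext i
  simp [dyadicEquiv, mul_comm]

theorem Summable.tsum_dyadic {p : ℕ} {φ : (Fin p → ℕ) → ℂ} (hφ : Summable φ) :
    ∑' k, φ k = ∑ ε : Fin p → Fin 2, ∑' m : Fin p → ℕ, φ fun i => 2 * m i + (ε i : ℕ) := by
  rw [← (dyadicEquiv p).tsum_eq φ, Summable.tsum_prod
    (f := fun x => φ (dyadicEquiv p x)) ((dyadicEquiv p).summable_iff.2 hφ), tsum_fintype]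
  simp only [dyadicEquiv_apply]

section Continuation

variable {p : ℕ} {ι : Type*} [Fintype ι]
  {f : ι → MvPolynomial (Fin p) ℂ} {ℓ : ι → (Fin p → ℕ) → ℂ}

theorem degForm_add_natCast (s : ι → ℂ) (l : ι → ℕ) :
    degForm f (fun j => s j + l j) = degForm f s + ((∑ j, (f j).totalDegree * l j : ℕ) : ℂ) := by
  simp only [degForm, mul_add, Finset.sum_add_distrib]
  push_cast
  rfl

theorem dyadicFactor_add_natCast (s : ι → ℂ) (l : ι → ℕ) :
    dyadicFactor f (fun j => s j + l j) =
      dyadicFactor f s * ((2 : ℂ) ^ ((∑ j, (f j).totalDegree * l j : ℕ) : ℤ))⁻¹ := by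
  rw [dyadicFactor, degForm_add_natCast, add_mul, neg_add, Complex.exp_add, dyadicFactor,
    Complex.exp_neg (_ * _), Complex.exp_neg (_ * _), Complex.exp_nat_mul,
    Complex.exp_log two_ne_zero, zpow_natCast]

theorem dyadicFactor_zero : dyadicFactor f 0 = 1 := by
  simp [dyadicFactor, degForm]

/-- Each factor `dilateDiff` loses one degree against `f_j`, and `l ≠ 0` supplies at least one such
factor. The added `∑ d_j l_j` is offset by the shift of `s` by `l`, so the order of the series drops
by at least 1. -/
theorem degLE_dilateMonomial {P : MvPolynomial (Fin p) ℂ} {b : ℤ} (hP : DegLE P b)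
    (ε : Fin p → Fin 2) {l : ι → ℕ} (hl : l ≠ 0) :
    DegLE (dilateMonomial f P ε l) (b - 1 + (∑ j, (f j).totalDegree * l j : ℕ)) := by
  have h1 := (hP.dilate_sub ε).1.mul (DegLE.prod (t := Finset.univ) fun j _ =>
    ((DegLE.of_totalDegree (f j)).dilate_sub ε).2.pow (l j))
  refine h1.mono ?_
  have h2 : 1 ≤ ∑ j, l j := by
    obtain ⟨j, hj⟩ := Function.ne_iff.1 hl
    exact (Nat.one_le_iff_ne_zero.2 hj).trans
      (Finset.single_le_sum (fun _ _ => Nat.zero_le _) (Finset.mem_univ j))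
  have h3 : ∑ j, (l j : ℤ) * (((f j).totalDegree : ℤ) - 1) =
      ((∑ j, (f j).totalDegree * l j : ℕ) : ℤ) - (∑ j, l j : ℕ) := by
    push_cast
    rw [← Finset.sum_sub_distrib]
    exact Finset.sum_congr rfl fun j _ => by ring
  rw [h3]
  omega

/-- The product of the factors that cancel the poles of the Dirichlet series in the half space
where the order of its terms is less than `M - p`. -/
noncomputable def poleFactor (f : ι → MvPolynomial (Fin p) ℂ) (b : ℤ) (M : ℕ) (s : ι → ℂ) : ℂ :=
  ∏ i ∈ Finset.range M, (1 - 2 ^ (p + b - i) * dyadicFactor f s)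

theorem differentiable_poleFactor (b : ℤ) (M : ℕ) : Differentiable ℂ (poleFactor f b M) := by
  unfold poleFactor
  induction M with
  | zero => simp
  | succ M ih =>
    simp only [Finset.prod_range_succ]
    exact ih.mul (((differentiable_dyadicFactor f).const_mul _).const_sub 1)

theorem poleFactor_succ (b : ℤ) (M : ℕ) (s : ι → ℂ) :
    poleFactor f b (M + 1) s =
      (1 - 2 ^ (p + b) * dyadicFactor f s) * poleFactor f (b - 1) M s := by
  rw [poleFactor, Finset.prod_range_succ', mul_comm, poleFactor]
  congr 1
  · simp
  · refine Finset.prod_congr rfl fun i _ => ?_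
    rw [show (p : ℤ) + b - (i + 1 : ℕ) = p + (b - 1) - i by push_cast; ring]

/-- Shifting `s` by `l` and raising `b` by `∑ d_j l_j` cancel in every factor, so a single pole
factor serves all terms of the functional equation. -/
theorem poleFactor_add_natCast (b : ℤ) (M : ℕ) (s : ι → ℂ) (l : ι → ℕ) :
    poleFactor f (b + (∑ j, (f j).totalDegree * l j : ℕ)) M (fun j => s j + l j) =
      poleFactor f b M s := by
  refine Finset.prod_congr rfl fun i _ => ?_
  rw [dyadicFactor_add_natCast,
    show (p : ℤ) + (b + (∑ j, (f j).totalDegree * l j : ℕ)) - i =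
      p + b - i + (∑ j, (f j).totalDegree * l j : ℕ) by ring, zpow_add₀ two_ne_zero]
  have : (2 : ℂ) ^ ((∑ j, (f j).totalDegree * l j : ℕ) : ℤ) ≠ 0 := zpow_ne_zero _ two_ne_zero
  field_simp

variable [DecidableEq ι]

/-- At `s = 0` only `l = 0` contributes, and both sides equal `P(2m + ε)`. This holds for every `m`,
since the logarithms no longer enter. -/
theorem dilateRemainder_apply_zero {N : ℕ} (hN : 0 < N) (P : MvPolynomial (Fin p) ℂ)
    (ε : Fin p → Fin 2) (m : Fin p → ℕ) : dilateRemainder f ℓ N P ε 0 m = 0 := by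
  have h0 : (0 : ι → ℕ) ∈ indexBox ι N := by simp [indexBox, hN]
  rw [dilateRemainder, dyadicFactor_zero, ← Finset.add_sum_erase _ _ h0, Finset.sum_eq_zero]
  · simp [dilateCoeff_zero, multiTerm, dilateMonomial, evalReal_dilate]
  · intro l hl
    rw [dilateCoeff_apply_zero (Finset.ne_of_mem_erase hl), zero_mul]

/-- The dyadic functional equation of the multivariable Dirichlet series. -/
theorem dyadic_functional_equation (hℓ : ∀ j, IsLatticeLog (f j) (ℓ j)) {N : ℕ} (hN : 0 < N)
    {P : MvPolynomial (Fin p) ℂ} {b : ℤ} (hP : DegLE P b) {s : ι → ℂ}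
    (hs : (b : ℝ) + p < (degForm f s).re) :
    (1 - 2 ^ (p + b) * dyadicFactor f s) * ∑' k, multiTerm ℓ P s k =
      ∑ ε : Fin p → Fin 2, (dyadicFactor f s *
        (∑' m, multiTerm ℓ (dilate ε P - MvPolynomial.C ((2 : ℂ) ^ b) * P) s m +
          ∑ l ∈ (indexBox ι N).erase 0, dilateCoeff f l s *
            ∑' m, multiTerm ℓ (dilateMonomial f P ε l) (fun j => s j + l j) m) +
        ∑' m, dilateRemainder f ℓ N P ε s m) := by
  have h0 : (0 : ι → ℕ) ∈ indexBox ι N := by simp [indexBox, hN]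
  have hsumP := (summable_differentiableAt_multiTerm hℓ hP hs).1
  have hsumQ : ∀ ε, Summable
      (multiTerm ℓ (dilate ε P - MvPolynomial.C ((2 : ℂ) ^ b) * P) s) := fun ε =>
    (summable_differentiableAt_multiTerm hℓ ((hP.dilate_sub ε).2.mono (by omega)) hs).1
  have hsumL : ∀ ε, ∀ l ∈ (indexBox ι N).erase 0, Summable
      (multiTerm ℓ (dilateMonomial f P ε l) fun j => s j + l j) := by
    intro ε l hl
    refine (summable_differentiableAt_multiTerm hℓ
      (degLE_dilateMonomial hP ε (Finset.ne_of_mem_erase hl)) ?_).1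
    rw [degForm_add_natCast, Complex.add_re, Complex.natCast_re]
    push_cast
    linarith
  have hsumR : ∀ ε, Summable (dilateRemainder f ℓ N P ε s) := fun ε =>
    (summable_differentiableAt_dilateRemainder hℓ N hP ε
      (by have : (0 : ℝ) ≤ N := Nat.cast_nonneg N
          linarith)).1
  have hterm : ∀ (ε : Fin p → Fin 2) (m : Fin p → ℕ),
      multiTerm ℓ P s (fun i => 2 * m i + (ε i : ℕ)) =
      dyadicFactor f s * (multiTerm ℓ (dilate ε P - MvPolynomial.C ((2 : ℂ) ^ b) * P) s m +
        2 ^ b * multiTerm ℓ P s m + ∑ l ∈ (indexBox ι N).erase 0, dilateCoeff f l s *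
          multiTerm ℓ (dilateMonomial f P ε l) (fun j => s j + l j) m) +
      dilateRemainder f ℓ N P ε s m := by
    intro ε m
    rw [dilateRemainder, ← Finset.add_sum_erase _ _ h0, dilateCoeff_zero]
    -- The term `l = 0` is split into a part of lower degree and `2 ^ b` times the original term,
    -- which moves to the left-hand side.
    have : multiTerm ℓ (dilateMonomial f P ε 0) (fun j => s j + (0 : ι → ℕ) j) m =
        multiTerm ℓ (dilate ε P - MvPolynomial.C ((2 : ℂ) ^ b) * P) s m +
          2 ^ b * multiTerm ℓ P s m := by
      simp only [multiTerm, dilateMonomial, evalReal, Pi.zero_apply, pow_zero,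
        Finset.prod_const_one, mul_one, Nat.cast_zero, add_zero, map_sub, map_mul,
        MvPolynomial.eval_C]
      ring
    rw [this]
    ring
  have hsplit : ∀ ε : Fin p → Fin 2,
      ∑' m : Fin p → ℕ, multiTerm ℓ P s (fun i => 2 * m i + (ε i : ℕ)) =
      dyadicFactor f s * (∑' m, multiTerm ℓ (dilate ε P - MvPolynomial.C ((2 : ℂ) ^ b) * P) s m +
        2 ^ b * ∑' m, multiTerm ℓ P s m + ∑ l ∈ (indexBox ι N).erase 0, dilateCoeff f l s *
          ∑' m, multiTerm ℓ (dilateMonomial f P ε l) (fun j => s j + l j) m) +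
      ∑' m, dilateRemainder f ℓ N P ε s m := by
    intro ε
    have hL : HasSum (fun m => ∑ l ∈ (indexBox ι N).erase 0, dilateCoeff f l s *
        multiTerm ℓ (dilateMonomial f P ε l) (fun j => s j + l j) m)
        (∑ l ∈ (indexBox ι N).erase 0, dilateCoeff f l s *
          ∑' m, multiTerm ℓ (dilateMonomial f P ε l) (fun j => s j + l j) m) :=
      hasSum_sum fun l hl => (hsumL ε l hl).hasSum.mul_left _
    simp only [hterm ε]
    exact (((((hsumQ ε).hasSum.add (hsumP.hasSum.mul_left _)).add hL).mul_left _).add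
      (hsumR ε).hasSum).tsum_eq
  have hmain := hsumP.tsum_dyadic
  simp only [hsplit] at hmain
  -- Each of the `2 ^ p` parity classes returns `2 ^ b * q(s)` times the original series; hence the
  -- exponent `p + b`.
  have hcard : ∑ _ε : Fin p → Fin 2, dyadicFactor f s * (2 ^ b * ∑' m, multiTerm ℓ P s m) =
      2 ^ (p + b) * dyadicFactor f s * ∑' m, multiTerm ℓ P s m := by
    rw [Finset.sum_const, Finset.card_univ, nsmul_eq_mul, Fintype.card_fun, Fintype.card_fin,
      Fintype.card_fin, zpow_add₀ two_ne_zero, zpow_natCast]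
    push_cast
    ring
  have hre : ∀ ε : Fin p → Fin 2, dyadicFactor f s *
        (∑' m, multiTerm ℓ (dilate ε P - MvPolynomial.C ((2 : ℂ) ^ b) * P) s m +
        2 ^ b * ∑' m, multiTerm ℓ P s m + ∑ l ∈ (indexBox ι N).erase 0, dilateCoeff f l s *
          ∑' m, multiTerm ℓ (dilateMonomial f P ε l) (fun j => s j + l j) m) +
      ∑' m, dilateRemainder f ℓ N P ε s m =
      (dyadicFactor f s *
        (∑' m, multiTerm ℓ (dilate ε P - MvPolynomial.C ((2 : ℂ) ^ b) * P) s m +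
          ∑ l ∈ (indexBox ι N).erase 0, dilateCoeff f l s *
            ∑' m, multiTerm ℓ (dilateMonomial f P ε l) (fun j => s j + l j) m) +
        ∑' m, dilateRemainder f ℓ N P ε s m) +
      dyadicFactor f s * (2 ^ b * ∑' m, multiTerm ℓ P s m) := fun ε => by ring
  rw [Finset.sum_congr rfl fun ε _ => hre ε, Finset.sum_add_distrib, hcard] at hmain
  rw [sub_mul, one_mul, sub_eq_iff_eq_add]
  exact hmain

/-- After multiplication by the pole factor, the multivariable Dirichlet series extends
holomorphically, and the extension vanishes at the origin. -/
theorem exists_continuation (hℓ : ∀ j, IsLatticeLog (f j) (ℓ j)) (M : ℕ) :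
    ∀ (P : MvPolynomial (Fin p) ℂ) (b : ℤ), DegLE P b → ∃ G : (ι → ℂ) → ℂ,
      (∀ s, (b : ℝ) + p - M < (degForm f s).re → DifferentiableAt ℂ G s) ∧
      (∀ s, (b : ℝ) + p < (degForm f s).re →
        G s = poleFactor f b M s * ∑' k, multiTerm ℓ P s k) ∧
      ((p : ℤ) + b < M → G 0 = 0) := by
  induction M with
  | zero =>
    intro P b hP
    refine ⟨fun s => ∑' k, multiTerm ℓ P s k, fun s hs => ?_, fun s _ => ?_, fun hb => ?_⟩
    · exact (summable_differentiableAt_multiTerm hℓ hP (by simpa using hs)).2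
    · simp [poleFactor]
    · have hP0 : P = 0 := hP.eq_zero (by push_cast at hb; omega)
      simp [hP0, multiTerm, evalReal]
  | succ M ih =>
    intro P b hP
    choose GQ hGQ1 hGQ2 hGQ3 using fun ε : Fin p → Fin 2 => ih _ _ (hP.dilate_sub ε).2
    have ihL : ∀ (ε : Fin p → Fin 2) (l : ι → ℕ), ∃ G : (ι → ℂ) → ℂ, l ≠ 0 →
        (∀ s, ((b - 1 + (∑ j, (f j).totalDegree * l j : ℕ) : ℤ) : ℝ) + p - M < (degForm f s).re →
          DifferentiableAt ℂ G s) ∧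
        (∀ s, ((b - 1 + (∑ j, (f j).totalDegree * l j : ℕ) : ℤ) : ℝ) + p < (degForm f s).re →
          G s = poleFactor f (b - 1 + (∑ j, (f j).totalDegree * l j : ℕ)) M s *
            ∑' k, multiTerm ℓ (dilateMonomial f P ε l) s k) := by
      intro ε l
      by_cases hl : l = 0
      · exact ⟨0, fun h => absurd hl h⟩
      · obtain ⟨G, h1, h2, -⟩ := ih _ _ (degLE_dilateMonomial hP ε hl)
        exact ⟨G, fun _ => ⟨h1, h2⟩⟩
    choose H hH using ihL
    -- The extension is the right-hand side of the functional equation times the remaining pole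
    -- factor. Truncation at order `M + 1` lets the remainder converge on the whole new half space.
    refine ⟨fun s => ∑ ε : Fin p → Fin 2, (dyadicFactor f s * (GQ ε s +
      ∑ l ∈ (indexBox ι (M + 1)).erase 0, dilateCoeff f l s * H ε l (fun j => s j + l j)) +
      poleFactor f (b - 1) M s * ∑' m, dilateRemainder f ℓ (M + 1) P ε s m),
      fun s hs => ?_, fun s hs => ?_, fun hb => ?_⟩
    · push_cast at hs
      refine DifferentiableAt.fun_sum fun ε _ => ?_
      refine ((differentiable_dyadicFactor f s).mul ((hGQ1 ε s ?_).add
        (DifferentiableAt.fun_sum fun l hl => (differentiable_dilateCoeff f l s).mul ?_))).add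
        ((differentiable_poleFactor (b - 1) M s).mul
          (summable_differentiableAt_dilateRemainder hℓ (M + 1) hP ε ?_).2)
      · push_cast
        linarith
      · refine DifferentiableAt.comp (g := H ε l) s
          ((hH ε l (Finset.ne_of_mem_erase hl)).1 _ ?_)
          ((differentiable_id.add_const fun j => (l j : ℂ)) s)
        rw [degForm_add_natCast, Complex.add_re, Complex.natCast_re]
        push_cast
        linarith
      · push_cast
        linarith
    · rw [poleFactor_succ, mul_right_comm, dyadic_functional_equation hℓ (Nat.succ_pos M) hP hs,
        Finset.sum_mul]
      refine Finset.sum_congr rfl fun ε _ => ?_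
      have hQ := hGQ2 ε s (by push_cast; linarith)
      have hL : ∀ l ∈ (indexBox ι (M + 1)).erase 0,
          dilateCoeff f l s * H ε l (fun j => s j + l j) =
          poleFactor f (b - 1) M s * (dilateCoeff f l s *
            ∑' m, multiTerm ℓ (dilateMonomial f P ε l) (fun j => s j + l j) m) := by
        intro l hl
        rw [(hH ε l (Finset.ne_of_mem_erase hl)).2, poleFactor_add_natCast]
        · ring
        · rw [degForm_add_natCast, Complex.add_re, Complex.natCast_re]
          push_cast
          linarith
      rw [hQ, Finset.sum_congr rfl hL, ← Finset.mul_sum]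
      ring
    · refine Finset.sum_eq_zero fun ε _ => ?_
      rw [hGQ3 ε (by push_cast at hb; omega), Finset.sum_eq_zero fun l hl => by
        rw [dilateCoeff_apply_zero (Finset.ne_of_mem_erase hl), zero_mul]]
      simp [dilateRemainder_apply_zero (Nat.succ_pos M)]

end Continuation

/-! ### Values at the origin -/

section Values

variable {p : ℕ} {ι : Type*} [Fintype ι]
  {f : ι → MvPolynomial (Fin p) ℂ} {ℓ : ι → (Fin p → ℕ) → ℂ}

theorem degForm_smul (t : ℂ) (a : ι → ℂ) : degForm f (t • a) = t * degForm f a := by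
  simp only [degForm, Pi.smul_apply, smul_eq_mul, Finset.mul_sum]
  exact Finset.sum_congr rfl fun j _ => by ring

theorem poleFactor_ne_zero {b : ℤ} {s : ι → ℂ} (hs : (b : ℝ) + p < (degForm f s).re) (M : ℕ) :
    poleFactor f b M s ≠ 0 := by
  refine Finset.prod_ne_zero_iff.2 fun i _ => ?_
  have hlt : ‖(2 : ℂ) ^ ((p : ℤ) + b - i) * dyadicFactor f s‖ < 1 := by
    have hlog : Complex.log 2 = (Real.log 2 : ℝ) := by
      rw [Complex.ofReal_log (by norm_num)]
      norm_num
    rw [norm_mul, norm_zpow, Complex.norm_ofNat, dyadicFactor, Complex.norm_exp, hlog,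
      Complex.neg_re, Complex.re_mul_ofReal, ← Real.rpow_intCast,
      Real.rpow_def_of_pos two_pos, ← Real.exp_add, Real.exp_lt_one_iff]
    have hpos := Real.log_pos one_lt_two
    have hi : (0 : ℝ) ≤ i := Nat.cast_nonneg i
    push_cast
    nlinarith
  intro h
  rw [← sub_eq_zero.1 h] at hlt
  simp at hlt

/-- L'Hôpital along the line `t • a`: `G` and `1 - q` both vanish at 0, and the latter has
derivative `δ * log 2 ≠ 0` there. -/
theorem tendsto_dyadic_quotient {G D : (ι → ℂ) → ℂ} {a : ι → ℂ} (hG : DifferentiableAt ℂ G 0)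
    (hG0 : G 0 = 0) (hD : Continuous D) (hD0 : D 0 ≠ 0) {δ : ℝ} (hδ : 0 < δ)
    (ha : degForm f a = δ) :
    Tendsto (fun t : ℂ => G (t • a) / (D (t • a) * (1 - dyadicFactor f (t • a)))) (𝓝[≠] 0)
      (𝓝 (fderiv ℂ G 0 a / (D 0 * (δ * Complex.log 2)))) := by
  have hlin : HasDerivAt (fun t : ℂ => t • a) a 0 := by
    simpa using (hasDerivAt_id (0 : ℂ)).smul_const a
  have h1 : HasDerivAt (fun t : ℂ => G (t • a)) (fderiv ℂ G 0 a) 0 := by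
    have hG' : HasFDerivAt G (fderiv ℂ G 0) ((0 : ℂ) • a) := by
      rw [zero_smul]
      exact hG.hasFDerivAt
    exact hG'.comp_hasDerivAt 0 hlin
  have h2 : HasDerivAt (fun t : ℂ => 1 - dyadicFactor f (t • a)) (δ * Complex.log 2) 0 := by
    have e : (fun t : ℂ => 1 - dyadicFactor f (t • a)) =
        fun t => 1 - Complex.exp (-(t * (δ * Complex.log 2))) := by
      funext t
      rw [dyadicFactor, degForm_smul, ha, mul_assoc]
    rw [e]
    have := (((hasDerivAt_id (0 : ℂ)).mul_const (δ * Complex.log 2)).neg.cexp).const_sub 1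
    simpa using this
  have hD' : Tendsto (fun t : ℂ => D (t • a)) (𝓝[≠] 0) (𝓝 (D 0)) := by
    have : Continuous fun t : ℂ => D (t • a) := by fun_prop
    simpa using (this.tendsto 0).mono_left nhdsWithin_le_nhds
  have hlog : Complex.log 2 ≠ 0 := by
    intro h
    have := Complex.exp_log (two_ne_zero (α := ℂ))
    rw [h, Complex.exp_zero] at this
    norm_num at this
  have hδ' : (δ : ℂ) ≠ 0 := by exact_mod_cast hδ.ne'
  have hq := (hasDerivAt_iff_tendsto_slope.1 h1).div (hD'.mul (hasDerivAt_iff_tendsto_slope.1 h2))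
    (mul_ne_zero hD0 (mul_ne_zero hδ' hlog))
  refine hq.congr' ?_
  filter_upwards [self_mem_nhdsWithin] with t ht
  have ht' : t ≠ 0 := ht
  have hq0 : dyadicFactor f 0 = 1 := dyadicFactor_zero
  simp only [Pi.div_apply, slope_def_field, zero_smul, hG0, hq0, sub_zero, sub_self]
  field_simp

/-- Along every direction `a` of positive degree `δ` the Dirichlet series extends
meromorphically, and `δ` times the value of the extension at `0` is linear in `a`. -/
theorem exists_linear_value (hℓ : ∀ j, IsLatticeLog (f j) (ℓ j)) (g : MvPolynomial (Fin p) ℂ) :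
    ∃ Λ : (ι → ℂ) →ₗ[ℂ] ℂ, ∀ (a : ι → ℂ) (δ : ℝ), 0 < δ → degForm f a = δ →
      ∃ F : ℂ → ℂ, MeromorphicOn F Set.univ ∧ AnalyticAt ℂ F 0 ∧
        (∃ σ : ℝ, ∀ s : ℂ, σ < s.re → HasSum (multiTerm ℓ g (s • a)) (F s)) ∧
        (δ : ℂ) * F 0 = Λ a := by
  classical
  set b : ℕ := g.totalDegree with hb
  choose G hG1 hG2 hG3 using fun M =>
    exists_continuation hℓ M g (b : ℤ) (DegLE.of_totalDegree g)
  -- The least `M` for which `G M` is known to vanish at 0. Its half space reaches down to `-1`,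
  -- hence contains 0, and its last pole factor, `i = p + b`, is `1 - q`.
  set M₀ := p + b + 1 with hM₀
  set D : (ι → ℂ) → ℂ := fun s => ∏ i ∈ Finset.range (p + b),
    (1 - 2 ^ ((p : ℤ) + (b : ℤ) - i) * dyadicFactor f s) with hD
  have hDpole : ∀ s, poleFactor f b M₀ s = D s * (1 - dyadicFactor f s) := by
    intro s
    rw [poleFactor, hM₀, Finset.prod_range_succ]
    simp [hD]
  have hDc : Continuous D := continuous_finsetProd _ fun i _ =>
    continuous_const.sub (continuous_const.mul (differentiable_dyadicFactor f).continuous)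
  have hD0 : D 0 ≠ 0 := by
    refine Finset.prod_ne_zero_iff.2 fun i hi => ?_
    rw [dyadicFactor_zero, mul_one, sub_ne_zero]
    have hi' := Finset.mem_range.1 hi
    rw [show (p : ℤ) + (b : ℤ) - i = (p + b - i : ℕ) by omega, zpow_natCast]
    exact_mod_cast (Nat.one_lt_two_pow (by omega : p + b - i ≠ 0)).ne
  refine ⟨(D 0 * Complex.log 2)⁻¹ • (fderiv ℂ (G M₀) 0).toLinearMap, fun a δ hδ ha => ?_⟩
  have hre : ∀ t : ℂ, (degForm f (t • a)).re = t.re * δ := by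
    intro t
    rw [degForm_smul, ha, Complex.re_mul_ofReal]
  have hlarge : ∀ t : ℂ, ((b : ℝ) + p) / δ < t.re →
      (((b : ℤ) : ℝ) + p < (degForm f (t • a)).re) := by
    intro t ht
    rw [hre, Int.cast_natCast]
    exact (div_lt_iff₀ hδ).1 ht
  have hdom : ∀ (M : ℕ) (t : ℂ), ((b : ℝ) + p) / δ - 1 / δ * M < t.re →
      ((b : ℤ) : ℝ) + p - M < (degForm f (t • a)).re := by
    intro M t ht
    rw [hre, Int.cast_natCast]
    have e : ((b : ℝ) + p) / δ - 1 / δ * M = (b + p - M) / δ := by ring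
    rw [e] at ht
    exact (div_lt_iff₀ hδ).1 ht
  have hlinear : Differentiable ℂ fun t : ℂ => t • a := differentiable_id.smul_const a
  obtain ⟨F, hF, hFeq, hFloc⟩ := exists_meromorphicOn_univ_of_halfPlanes
    (φ := fun t => ∑' k, multiTerm ℓ g (t • a) k) (σ := ((b : ℝ) + p) / δ) (c := 1 / δ)
    (F := fun M t => G M (t • a) / poleFactor f b M (t • a)) (by positivity)
    (fun M t ht => by
      have hopen : IsOpen {t : ℂ | ((b : ℝ) + p) / δ - 1 / δ * M < t.re} :=
        isOpen_lt continuous_const Complex.continuous_re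
      have h1 : DifferentiableOn ℂ (fun t : ℂ => G M (t • a))
          {t : ℂ | ((b : ℝ) + p) / δ - 1 / δ * M < t.re} := fun z hz =>
        ((hG1 M _ (hdom M z hz)).comp z (hlinear z)).differentiableWithinAt
      have h2 : Differentiable ℂ fun t : ℂ => poleFactor f b M (t • a) :=
        (differentiable_poleFactor (f := f) (b : ℤ) M).comp hlinear
      exact (h1.analyticAt (hopen.mem_nhds ht)).meromorphicAt.div (h2.analyticAt t).meromorphicAt)
    (fun M t ht => by
      have := poleFactor_ne_zero (hlarge t ht) M
      rw [hG2 M _ (hlarge t ht)]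
      field_simp)
  set v := fderiv ℂ (G M₀) 0 a / (D 0 * (δ * Complex.log 2)) with hv
  have hzero : ((b : ℤ) : ℝ) + p - M₀ < (degForm f (0 : ι → ℂ)).re := by
    simp [degForm, hM₀]
    linarith
  have hlim : Tendsto F (𝓝[≠] 0) (𝓝 v) := by
    have h1 := tendsto_dyadic_quotient (hG1 M₀ 0 hzero) (hG3 M₀ (by rw [hM₀]; push_cast; omega))
      hDc hD0 hδ ha
    refine h1.congr' ?_
    have h2 := hFloc M₀ 0 (by
      rw [Complex.zero_re, hM₀]
      push_cast
      have : ((b : ℝ) + p) / δ - 1 / δ * (p + b + 1) = -(1 / δ) := by ring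
      rw [this]
      have : 0 < 1 / δ := by positivity
      linarith)
    filter_upwards [h2] with t ht
    rw [ht, hDpole]
  -- The quotient defining the continuation near 0 reads 0/0 at the origin, so the limit has to be
  -- inserted there to obtain an analytic function.
  have hupd : ∀ t, Function.update F 0 v =ᶠ[𝓝[≠] t] F := by
    intro t
    have h0 : ∀ᶠ z in 𝓝[≠] t, z ≠ 0 := by
      by_cases ht : t = 0
      · rw [ht]
        exact self_mem_nhdsWithin
      · exact nhdsWithin_le_nhds (isOpen_ne.mem_nhds ht)
    filter_upwards [h0] with z hz
    exact Function.update_of_ne hz _ _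
  have hmero : MeromorphicOn (Function.update F 0 v) Set.univ := fun t ht =>
    (hF t ht).congr (hupd t).symm
  refine ⟨Function.update F 0 v, hmero, ?_, ⟨((b : ℝ) + p) / δ, fun s hs => ?_⟩, ?_⟩
  · exact (hmero 0 trivial).analyticAt (continuousAt_update_same.2 hlim)
  · have hs0 : s ≠ 0 := by
      rintro rfl
      have : 0 ≤ ((b : ℝ) + p) / δ := by positivity
      simp only [Complex.zero_re] at hs
      linarith
    rw [Function.update_of_ne hs0, hFeq s hs]
    exact (summable_differentiableAt_multiTerm hℓ (DegLE.of_totalDegree g)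
      (by rw [← hb]; exact hlarge s hs)).1.hasSum
  · have hδ' : (δ : ℂ) ≠ 0 := by exact_mod_cast hδ.ne'
    rw [Function.update_self, hv]
    simp only [LinearMap.smul_apply, smul_eq_mul, ContinuousLinearMap.coe_coe]
    field_simp

end Values

/-! ### Independence of the branch and the product rule -/

/-- The difference divided by 2πi is continuous and integer-valued on the convex octant, hence
constant. -/
theorem IsLogBranch.exists_eq_add {p : ℕ} {f : MvPolynomial (Fin p) ℂ} {ℓ ℓ' : (Fin p → ℝ) → ℂ}
    (h : IsLogBranch f ℓ) (h' : IsLogBranch f ℓ') :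
    ∃ c : ℂ, ∀ x ∈ octant p, ℓ' x = ℓ x + c := by
  have hint : ∀ x ∈ octant p, ∃ n : ℤ, ℓ' x = ℓ x + n * (2 * Real.pi * Complex.I) := fun x hx =>
    Complex.exp_eq_exp_iff_exists_int.1 ((h'.exp_eq x hx).trans (h.exp_eq x hx).symm)
  have hdisc : DiscreteTopology (Set.range ((↑) : ℤ → ℝ)) :=
    Int.isClosedEmbedding_coe_real.isEmbedding.toHomeomorph.symm.isEmbedding.discreteTopology
  have hval : ∀ (x) (n : ℤ), ℓ' x = ℓ x + n * (2 * Real.pi * Complex.I) →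
      (ℓ' x - ℓ x).im / (2 * Real.pi) = n := by
    intro x n hn
    have hpi : (2 * Real.pi) ≠ 0 := by positivity
    rw [hn, add_sub_cancel_left]
    have : ((n : ℂ) * (2 * Real.pi * Complex.I)).im = n * (2 * Real.pi) := by
      rw [show (n : ℂ) * (2 * Real.pi * Complex.I) = ((n * (2 * Real.pi) : ℝ) : ℂ) * Complex.I by
        push_cast; ring, Complex.im_ofReal_mul, Complex.I_im, mul_one]
    rw [this]
    field_simp
  obtain ⟨y, -, hy⟩ := (convex_octant p).isPreconnected.eqOn_const_of_mapsTo
    (T := Set.range ((↑) : ℤ → ℝ)) (f := fun x => (ℓ' x - ℓ x).im / (2 * Real.pi)) ⟨hdisc⟩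
    ((Complex.continuous_im.comp_continuousOn (h'.continuousOn.sub h.continuousOn)).div_const _)
    (fun x hx => by
      obtain ⟨n, hn⟩ := hint x hx
      exact ⟨n, (hval x n hn).symm⟩) ⟨0, 0, by simp⟩
  refine ⟨y * (2 * Real.pi * Complex.I), fun x hx => ?_⟩
  obtain ⟨n, hn⟩ := hint x hx
  have := hy hx
  simp only [Function.const_apply] at this
  rw [hval x n hn] at this
  rw [hn, ← this, Complex.ofReal_intCast]

/-- Two branches differ by a constant `c`, so the continuations differ by the factor `exp (-s * c)`,
first in a half plane and then, by the identity theorem, near 0, where this factor takes the value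
1. -/
theorem IsZetaValueAtZero.unique {p : ℕ} {f g : MvPolynomial (Fin p) ℂ} {v v' : ℂ}
    (h : IsZetaValueAtZero f g v) (h' : IsZetaValueAtZero f g v') : v = v' := by
  obtain ⟨ℓ, F, hℓ, hF, rfl⟩ := h
  obtain ⟨ℓ', F', hℓ', hF', rfl⟩ := h'
  obtain ⟨c, hc⟩ := hℓ.exists_eq_add hℓ'
  obtain ⟨σ, hσ⟩ := hF.hasSum
  obtain ⟨σ', hσ'⟩ := hF'.hasSum
  have hexp : AnalyticOnNhd ℂ (fun s : ℂ => Complex.exp (-s * c)) Set.univ := fun s _ =>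
    (by fun_prop : Differentiable ℂ fun s : ℂ => Complex.exp (-s * c)).analyticAt s
  have heq : ∀ s : ℂ, max σ σ' < s.re → F' s = Complex.exp (-s * c) * F s := by
    intro s hs
    refine (hσ' s ((le_max_right _ _).trans_lt hs)).unique ?_
    have hterm : zetaTerm g ℓ' s = fun k => Complex.exp (-s * c) * zetaTerm g ℓ s k := by
      funext k
      rw [zetaTerm, zetaTerm, hc _ (natCast_mem_octant k), mul_add, Complex.exp_add]
      ring
    rw [hterm]
    exact (hσ s ((le_max_left _ _).trans_lt hs)).mul_left _
  have hev : F' =ᶠ[𝓝[≠] 0] fun s => Complex.exp (-s * c) * F s := by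
    refine MeromorphicOn.eventuallyEq_of_isPreconnected isPreconnected_univ hF'.meromorphicOn
      (hexp.meromorphicOn.mul hF.meromorphicOn) (x := ((max σ σ' + 1 : ℝ) : ℂ)) trivial trivial ?_
    refine Filter.Eventually.filter_mono nhdsWithin_le_nhds ?_
    have : {t : ℂ | max σ σ' < t.re} ∈ 𝓝 ((max σ σ' + 1 : ℝ) : ℂ) :=
      (isOpen_lt continuous_const Complex.continuous_re).mem_nhds (by
        change max σ σ' < (((max σ σ' + 1 : ℝ) : ℂ)).re
        rw [Complex.ofReal_re]
        exact lt_add_one _)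
    filter_upwards [this] with s hs using heq s hs
  have hcont : ContinuousAt (fun s => Complex.exp (-s * c) * F s) 0 :=
    (hexp 0 trivial).continuousAt.mul hF.analyticAt_zero.continuousAt
  have := ((hF'.analyticAt_zero.continuousAt.eventuallyEq_nhds_iff_eventuallyEq_nhdsNE
    hcont).1 hev).eq_of_nhds
  simpa using this.symm

theorem totalDegree_prod_of_ne_zero {p : ℕ} {α : Type*} (t : Finset α)
    {f : α → MvPolynomial (Fin p) ℂ} (hf : ∀ j ∈ t, f j ≠ 0) :
    (∏ j ∈ t, f j).totalDegree = ∑ j ∈ t, (f j).totalDegree := by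
  classical
  induction t using Finset.induction_on with
  | empty => simp
  | insert a t ha ih =>
    have ht : ∀ j ∈ t, f j ≠ 0 := fun j hj => hf j (Finset.mem_insert_of_mem hj)
    rw [Finset.prod_insert ha, Finset.sum_insert ha, MvPolynomial.totalDegree_mul_of_isDomain
      (hf a (Finset.mem_insert_self a t)) (Finset.prod_ne_zero_iff.2 ht), ih ht]

theorem IsLogBranch.prod {p : ℕ} {α : Type*} (t : Finset α) {f : α → MvPolynomial (Fin p) ℂ}
    {ℓ : α → (Fin p → ℝ) → ℂ} (h : ∀ j, IsLogBranch (f j) (ℓ j)) :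
    IsLogBranch (∏ j ∈ t, f j) fun x => ∑ j ∈ t, ℓ j x := by
  refine ⟨continuousOn_finsetSum _ fun j _ => (h j).continuousOn, fun x hx => ?_⟩
  rw [Complex.exp_sum, evalReal, map_prod]
  exact Finset.prod_congr rfl fun j _ => (h j).exp_eq x hx

end

/-- The values `ζ(0; f_j, g)` and `ζ(0; ∏ f_j, g)` exist and are well defined (independent of the
branch of the logarithm), and they satisfy the product rule. -/
theorem theorem1 {p n : ℕ} (hn : 1 ≤ n) (f : Fin n → MvPolynomial (Fin p) ℂ)
    (g : MvPolynomial (Fin p) ℂ) (hf : ∀ j, MahlerHypothesis (f j)) :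
    (∀ j, ∃! v : ℂ, IsZetaValueAtZero (f j) g v) ∧
    (∃! w : ℂ, IsZetaValueAtZero (∏ j, f j) g w) ∧
    ∀ (v : Fin n → ℂ) (w : ℂ), (∀ j, IsZetaValueAtZero (f j) g (v j)) →
      IsZetaValueAtZero (∏ j, f j) g w →
      ((∏ j, f j).totalDegree : ℂ) * w = ∑ j, ((f j).totalDegree : ℂ) * v j := by
  choose ℓ hℓ hlat using fun j => (hf j).exists_isLogBranch
  obtain ⟨Λ, hΛ⟩ := exists_linear_value hlat g
  have hdeg : (∏ j, f j).totalDegree = ∑ j, (f j).totalDegree :=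
    totalDegree_prod_of_ne_zero _ fun j _ h => by
      have := (hf j).nonconstant
      simp [h] at this
  have hsingle : ∀ j, ∃ v, IsZetaValueAtZero (f j) g v ∧
      ((f j).totalDegree : ℂ) * v = Λ (Pi.single j 1) := by
    intro j
    obtain ⟨F, hF, hF0, ⟨σ, hσ⟩, hval⟩ := hΛ (Pi.single j 1) (f j).totalDegree
      (by exact_mod_cast (hf j).nonconstant) (by simp [degForm, Pi.single_apply])
    refine ⟨F 0, ⟨ℓ j, F, hℓ j, ⟨hF, hF0, σ, fun s hs => ?_⟩, rfl⟩, by simpa using hval⟩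
    have hterm : zetaTerm g (ℓ j) s =
        multiTerm (fun j m => ℓ j fun i => (m i : ℝ)) g (s • Pi.single j 1) := by
      funext k
      simp [zetaTerm, multiTerm, Pi.single_apply]
    rw [hterm]
    exact hσ s hs
  have hprod : ∃ w, IsZetaValueAtZero (∏ j, f j) g w ∧
      ((∏ j, f j).totalDegree : ℂ) * w = Λ fun _ => 1 := by
    have hpos : 0 < (∏ j, f j).totalDegree := by
      rw [hdeg]
      exact Finset.sum_pos (fun j _ => (hf j).nonconstant) ⟨⟨0, hn⟩, Finset.mem_univ _⟩
    obtain ⟨F, hF, hF0, ⟨σ, hσ⟩, hval⟩ := hΛ (fun _ => 1) (∏ j, f j).totalDegree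
      (by exact_mod_cast hpos) (by simp [degForm, hdeg])
    refine ⟨F 0, ⟨_, F, IsLogBranch.prod Finset.univ hℓ, ⟨hF, hF0, σ, fun s hs => ?_⟩, rfl⟩,
      by simpa using hval⟩
    have hterm : zetaTerm g (fun x => ∑ j, ℓ j x) s =
        multiTerm (fun j m => ℓ j fun i => (m i : ℝ)) g (s • fun _ => 1) := by
      funext k
      simp [zetaTerm, multiTerm, Finset.mul_sum]
    rw [hterm]
    exact hσ s hs
  refine ⟨fun j => ?_, ?_, fun v w hv hw => ?_⟩
  · obtain ⟨v, hv, -⟩ := hsingle j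
    exact ⟨v, hv, fun v' hv' => hv'.unique hv⟩
  · obtain ⟨w, hw, -⟩ := hprod
    exact ⟨w, hw, fun w' hw' => hw'.unique hw⟩
  · obtain ⟨w', hw', hw1⟩ := hprod
    -- The direction of the product series is the sum of the directions of the single series;
    -- linearity of `Λ` is now the product rule.
    have hsum : (fun _ => 1 : Fin n → ℂ) = ∑ j, Pi.single j 1 := by
      funext i
      simp [Finset.sum_apply, Pi.single_apply]
    rw [hw.unique hw', hw1, hsum, map_sum]
    refine Finset.sum_congr rfl fun j _ => ?_
    obtain ⟨v', hv', hv1⟩ := hsingle j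
    rw [(hv j).unique hv', hv1]
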